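/- Let $N\ge 2$, let $\Omega\subset\mathbb R^N$ be a bounded domain (nonempty, open, connected) with Lipschitz boundary, and let $p\in C(\overline\Omega)$ satisfy $1<\inf_\Omega p\le\sup_\Omega p<N$ and be log-Hölder continuous: for some $L>0$, $|p(x)-p(y)|\le -L/\log|x-y|$ for all $x,y\in\Omega$ with $0<|x-y|\le 1/2$. Let $L^{p(x)}(\Omega)$ be the space of measurable $u$ with $\int_\Omega|u|^{p(x)}\,dx<\infty$, with the Luxemburg norm $\|u\|_{p(x)}=\inf\{\gamma>0:\int_\Omega|u/\gamma|^{p(x)}dx\le1\}$, and let $W_0^{1,p(x)}(\Omega)$ be the closure of $C_c^\infty(\Omega)$ in $W^{1,p(x)}(\Omega)=\{u\in L^{p(x)}(\Omega):\nabla u\in L^{p(x)}(\Omega)\}$ with respect to $\|u\|_{p(x)}+\|\nabla u\|_{p(x)}$, endowed with the norm $\|\nabla u\|_{p(x)}$. Define $\mathscr E_{p(x)}:L^1(\Omega)\to[0,\infty]$ and $g_{p(x)}:L^1(\Omega)\to[0,\infty)$ by $$\mathscr E_{p(x)}(u)=\begin{cases}\|\nabla u\|_{p(x)}&\text{if }u\in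 W_0^{1,p(x)}(\Omega),\\+\infty&\text{otherwise,}\end{cases}\qquad g_{p(x)}(u)=\begin{cases}\|u\|_{p(x)}&\text{if }u\in L^{p(x)}(\Omega),\\0&\text{otherwise.}\end{cases}$$ The Krasnosel'skiĭ genus $i(K)$ of a symmetric set $K=-K$ is the least integer $k\ge0$ for which there is a continuous odd map $K\to\mathbb R^k\setminus\{0\}$ ($i(K)=\infty$ if there is none; $i(\emptyset)=0$). For $m\ge1$ let $\mathcal K^{(m)}_{s,p(x)}$ be the family of the symmetric subsets $K$ of $\{u\in L^1(\Omega):g_{p(x)}(u)=1\}$ that are compact and satisfy $i(K)\ge m$ with respect to the topology of $L^1(\Omega)$, and let $\mathcal W^{(m)}_{s,p(x)}$ be the family of the symmetric subsets $K$ of $\{u\in W_0^{1,p(x)}(\Omega):g_{p(x)}(u)=1\}$ that are compact and satisfy $i(K)\ge m$ with respect to the norm topology of $W_0^{1,p(x)}(\Omega)$. Then $\mathscr E_{p(x)}$ is convex, even and positively homogeneous of degree $1$ (that is, $\mathscr E_{p(x)}(tu)=t\,\mathscr E_{p(x)}(u)$ for all $t\ge0$ and $u\in L^1(\Omega)$,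 with $0\cdot\infty=0$), and for every integer $m\ge1$ $$\inf_{K\in\mathcal K^{(m)}_{s,p(x)}}\ \sup_{u\in K}\mathscr E_{p(x)}(u)=\inf_{K\in\mathcal W^{(m)}_{s,p(x)}}\ \sup_{u\in K}\mathscr E_{p(x)}(u).$$ -/

import Mathlib

open MeasureTheory Set
open scoped ENNReal NNReal ContDiff Pointwise

namespace VarExp

/-- `ℝ^N` with its Euclidean norm. -/
abbrev Euc (N : ℕ) : Type := EuclideanSpace ℝ (Fin N)

variable {N : ℕ}

/-- Near each of its boundary points, `Ω` is (in suitable orthonormal coordinates) the region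
strictly above the graph of a Lipschitz function of `N - 1` variables. -/
def HasLipschitzBoundary (Ω : Set (Euc N)) : Prop :=
  ∀ x₀ ∈ frontier Ω, ∃ e : Euc N, ‖e‖ = 1 ∧
    ∃ (r : ℝ) (C : ℝ≥0) (γ : (Submodule.span ℝ {e})ᗮ → ℝ), 0 < r ∧ LipschitzWith C γ ∧
      ∀ x ∈ Metric.ball x₀ r,
        (x ∈ Ω ↔ γ ((Submodule.span ℝ {e})ᗮ.orthogonalProjectionOnto x) < inner ℝ e x)

/-- The class `𝒞` of admissible exponents on `Ω`. Only the values of `p` on `closure Ω` matter. -/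
structure AdmissibleExponent (Ω : Set (Euc N)) (p : Euc N → ℝ) : Prop where
  continuousOn : ContinuousOn p (closure Ω)
  one_lt_inf : 1 < sInf (p '' Ω)
  sup_lt : sSup (p '' Ω) < N
  log_holder : ∃ L : ℝ, 0 < L ∧ ∀ x ∈ Ω, ∀ y ∈ Ω, 0 < dist x y → dist x y ≤ 1 / 2 →
    |p x - p y| ≤ -(L / Real.log (dist x y))

section Lebesgue

variable {F : Type*} [NormedAddCommGroup F]

/-- The `p(x)`-modular `∫_Ω |f|^{p(x)} dx`. -/
noncomputable def modular (Ω : Set (Euc N)) (p : Euc N → ℝ) (f : Euc N → F) : ℝ≥0∞ :=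
  ∫⁻ x in Ω, ‖f x‖ₑ ^ p x

/-- Membership in `L^{p(x)}(Ω)`. -/
def MemLpx (Ω : Set (Euc N)) (p : Euc N → ℝ) (f : Euc N → F) : Prop :=
  AEStronglyMeasurable f (volume.restrict Ω) ∧ modular Ω p f < ⊤

/-- The Luxemburg norm `‖f‖_{p(x)}` (with value `∞` when no `γ > 0` is admissible). -/
noncomputable def luxNorm [NormedSpace ℝ F] (Ω : Set (Euc N)) (p : Euc N → ℝ)
    (f : Euc N → F) : ℝ≥0∞ :=
  ⨅ (γ : ℝ) (_ : 0 < γ) (_ : modular Ω p (fun x => γ⁻¹ • f x) ≤ 1), ENNReal.ofReal γ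

end Lebesgue

/-- Smooth functions with compact support contained in `Ω`. -/
def IsTestFunction (Ω : Set (Euc N)) (φ : Euc N → ℝ) : Prop :=
  ContDiff ℝ ∞ φ ∧ HasCompactSupport φ ∧ tsupport φ ⊆ Ω

/-- `G` is the distributional gradient of `u` on `Ω`. -/
def IsWeakGrad (Ω : Set (Euc N)) (u : Euc N → ℝ) (G : Euc N → Euc N) : Prop :=
  LocallyIntegrableOn u Ω ∧ LocallyIntegrableOn G Ω ∧
    ∀ φ : Euc N → ℝ, IsTestFunction Ω φ →
      ∫ x in Ω, u x • gradient φ x = -∫ x in Ω, φ x • G x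

open Classical in
/-- The distributional gradient of `u` on `Ω` (unique almost everywhere), when there is one. -/
noncomputable def weakGrad (Ω : Set (Euc N)) (u : Euc N → ℝ) : Euc N → Euc N :=
  if h : ∃ G, IsWeakGrad Ω u G then h.choose else 0

/-- Membership in `W_0^{1,p(x)}(Ω)`: `u` belongs to `W^{1,p(x)}(Ω)` and is a limit of test functions
in the norm `‖u‖_{p(x)} + ‖∇u‖_{p(x)}`. -/
def MemW0 (Ω : Set (Euc N)) (p : Euc N → ℝ) (u : Euc N → ℝ) : Prop :=
  MemLpx Ω p u ∧ ∃ G : Euc N → Euc N, IsWeakGrad Ω u G ∧ MemLpx Ω p G ∧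
    ∀ ε : ℝ≥0∞, 0 < ε → ∃ φ : Euc N → ℝ, IsTestFunction Ω φ ∧
      luxNorm Ω p (fun x => u x - φ x) + luxNorm Ω p (fun x => G x - gradient φ x) < ε

/-- `L¹(Ω)` with its norm topology. -/
abbrev L1 (Ω : Set (Euc N)) : Type := Lp ℝ 1 (volume.restrict Ω)

/-- `‖∇u‖_{p(x)}`. -/
noncomputable def gradNorm (Ω : Set (Euc N)) (p : Euc N → ℝ) (u : L1 Ω) : ℝ≥0∞ :=
  luxNorm Ω p (weakGrad Ω u)

open Classical in
/-- The functional `ℰ_{p(x)} : L¹(Ω) → [0, ∞]`. -/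
noncomputable def energy (Ω : Set (Euc N)) (p : Euc N → ℝ) (u : L1 Ω) : ℝ≥0∞ :=
  if MemW0 Ω p u then gradNorm Ω p u else ⊤

open Classical in
/-- The functional `g_{p(x)} : L¹(Ω) → [0, ∞)`. -/
noncomputable def gFun (Ω : Set (Euc N)) (p : Euc N → ℝ) (u : L1 Ω) : ℝ≥0 :=
  if MemLpx Ω p u then (luxNorm Ω p u).toNNReal else 0

/-- The space `W_0^{1,p(x)}(Ω)`. A type of its own: it does not carry the topology of `L¹(Ω)`. -/
def W0 (Ω : Set (Euc N)) (p : Euc N → ℝ) : Type := {u : L1 Ω // MemW0 Ω p u}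

/-- The norm topology of `W_0^{1,p(x)}(Ω)` for the norm `‖∇u‖_{p(x)}`: a set is open when it contains
a ball around each of its points. -/
instance W0.instTopologicalSpace (Ω : Set (Euc N)) (p : Euc N → ℝ) :
    TopologicalSpace (W0 Ω p) where
  IsOpen U := ∀ u ∈ U, ∃ ε : ℝ≥0∞, 0 < ε ∧ ∀ v : W0 Ω p, gradNorm Ω p (v.1 - u.1) < ε → v ∈ U
  isOpen_univ := fun _ _ => ⟨1, one_pos, fun _ _ => mem_univ _⟩
  isOpen_inter := by
    rintro U V hU hV u ⟨hu, hv⟩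
    obtain ⟨a, ha, hUa⟩ := hU u hu
    obtain ⟨b, hb, hVb⟩ := hV u hv
    exact ⟨min a b, lt_min ha hb, fun v h =>
      ⟨hUa v (h.trans_le (min_le_left _ _)), hVb v (h.trans_le (min_le_right _ _))⟩⟩
  isOpen_sUnion := by
    rintro S hS u ⟨U, hU, hu⟩
    obtain ⟨a, ha, h⟩ := hS U hU u hu
    exact ⟨a, ha, fun v hv => ⟨U, hU, h v hv⟩⟩

section Neg

variable {F : Type*} [NormedAddCommGroup F]

theorem modular_congr {Ω : Set (Euc N)} {p : Euc N → ℝ} {F' : Type*} [NormedAddCommGroup F']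
    {f : Euc N → F} {g : Euc N → F'} (h : ∀ᵐ x ∂volume.restrict Ω, ‖f x‖ₑ = ‖g x‖ₑ) :
    modular Ω p f = modular Ω p g :=
  lintegral_congr_ae (h.mono fun x hx => by simp only [hx])

theorem luxNorm_congr [NormedSpace ℝ F] {Ω : Set (Euc N)} {p : Euc N → ℝ}
    {f g : Euc N → F} (h : ∀ᵐ x ∂volume.restrict Ω, ‖f x‖ₑ = ‖g x‖ₑ) :
    luxNorm Ω p f = luxNorm Ω p g := by
  have key : ∀ γ : ℝ, modular Ω p (fun x => γ⁻¹ • f x) = modular Ω p (fun x => γ⁻¹ • g x) :=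
    fun γ => modular_congr (h.mono fun x hx => by simp only [enorm_smul, hx])
  simp only [luxNorm, key]

theorem gradient_fun_neg (φ : Euc N → ℝ) (x : Euc N) :
    gradient (fun y => -φ y) x = -gradient φ x := by
  simp [gradient, fderiv_fun_neg]

theorem IsTestFunction.neg {Ω : Set (Euc N)} {φ : Euc N → ℝ} (h : IsTestFunction Ω φ) :
    IsTestFunction Ω (fun x => -φ x) := by
  have hs : Function.support (fun x => -φ x) = Function.support φ := by
    ext x; simp
  refine ⟨h.1.neg, ?_, ?_⟩
  · have := h.2.1
    rw [HasCompactSupport, tsupport] at this ⊢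
    rwa [hs]
  · have := h.2.2
    rw [tsupport] at this ⊢
    rwa [hs]

theorem MemW0.neg {Ω : Set (Euc N)} {p : Euc N → ℝ} {u : L1 Ω} (h : MemW0 Ω p u) :
    MemW0 Ω p (-u : L1 Ω) := by
  obtain ⟨hu, G, ⟨hG1, hG2, hG3⟩, hG, happ⟩ := h
  have hneg : ∀ᵐ x ∂volume.restrict Ω, (-u : L1 Ω) x = -u x := Lp.coeFn_neg u
  refine ⟨⟨Lp.aestronglyMeasurable _, ?_⟩, fun x => -G x, ⟨?_, ?_, ?_⟩, ⟨hG.1.neg, ?_⟩, ?_⟩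
  · rw [modular_congr (g := u) (hneg.mono fun x hx => by rw [hx, enorm_neg])]
    exact hu.2
  · have : Integrable (-u : L1 Ω) (volume.restrict Ω) := L1.integrable_coeFn _
    exact IntegrableOn.locallyIntegrableOn this
  · exact hG2.neg
  · intro φ hφ
    have h1 : ∫ x in Ω, (-u : L1 Ω) x • gradient φ x = ∫ x in Ω, -(u x • gradient φ x) :=
      integral_congr_ae (hneg.mono fun x hx => by simp only [hx, neg_smul])
    rw [h1, integral_neg, hG3 φ hφ]
    simp only [smul_neg, integral_neg]
  · rw [modular_congr (g := G) (Filter.Eventually.of_forall fun x => enorm_neg _)]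
    exact hG.2
  · intro ε hε
    obtain ⟨φ, hφ, hlt⟩ := happ ε hε
    refine ⟨fun x => -φ x, hφ.neg, ?_⟩
    rw [luxNorm_congr (g := fun x => u x - φ x) (hneg.mono fun x hx => ?_),
      luxNorm_congr (g := fun x => G x - gradient φ x) (Filter.Eventually.of_forall fun x => ?_)]
    · exact hlt
    · have e : -G x - gradient (fun y => -φ y) x = -(G x - gradient φ x) := by
        rw [gradient_fun_neg]; abel
      rw [e, enorm_neg]
    · have e : (-u : L1 Ω) x - -φ x = -(u x - φ x) := by
        rw [hx]; ring
      rw [e, enorm_neg]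

end Neg

noncomputable instance W0.instNeg (Ω : Set (Euc N)) (p : Euc N → ℝ) : Neg (W0 Ω p) :=
  ⟨fun u => ⟨-u.1, u.2.neg⟩⟩

/-- The Krasnosel'skii genus of a symmetric set `A`: the least `k` for which there is an odd
continuous map from `A` to `ℝ^k` without zeros (`∞` if there is none, `0` for the empty set). -/
noncomputable def genus {X : Type*} [TopologicalSpace X] [Neg X] (A : Set X) : ℕ∞ :=
  ⨅ (k : ℕ) (_ : ∃ f : X → EuclideanSpace ℝ (Fin k), ContinuousOn f A ∧
    (∀ x ∈ A, f (-x) = -f x) ∧ ∀ x ∈ A, f x ≠ 0), (k : ℕ∞)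

/-- The compact symmetric subsets of `S` with genus at least `m`, everything being understood in the
topology of `X`. -/
def symmFamily {X : Type*} [TopologicalSpace X] [Neg X] (S : Set X) (m : ℕ) : Set (Set X) :=
  {K | K ⊆ S ∧ IsCompact K ∧ K = -K ∧ (m : ℕ∞) ≤ genus K}

/-- The family of subsets of `{u ∈ L¹(Ω) : g_{p(x)}(u) = 1}`, with the topology of `L¹(Ω)`. -/
def familyL1 (Ω : Set (Euc N)) (p : Euc N → ℝ) (m : ℕ) : Set (Set (L1 Ω)) :=
  symmFamily {u : L1 Ω | gFun Ω p u = 1} m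

/-- The family of subsets of `{u ∈ W_0^{1,p(x)}(Ω) : g_{p(x)}(u) = 1}`, with the norm topology of
`W_0^{1,p(x)}(Ω)`. -/
def familyW0 (Ω : Set (Euc N)) (p : Euc N → ℝ) (m : ℕ) : Set (Set (W0 Ω p)) :=
  symmFamily {u : W0 Ω p | gFun Ω p u.1 = 1} m

end VarExp

/-!
Around each point of `closure Ω` there are exponents `r ≤ p < q` for which the `L^q` norm of
cut-offs is controlled by the Gagliardo–Nirenberg–Sobolev inequality for `r`, and
`t^p ≤ ε t^q + C t` turns this into a bound of the local modular by `ε` plus a multiple of the `L¹`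
norm. Finitely many such bounds cover the compact set `closure Ω`; by homogeneity, for every
`η > 0`,

  `‖u‖_{p(x)} ≤ η ‖∇u‖_{p(x)} + C_η ‖u‖_{L¹}`.

A competitor in `familyW0` is a competitor in `familyL1`, as `W_0^{1,p(x)}` embeds continuously in
`L¹`. Conversely, let the energies on `K ∈ familyL1` be at most `c`. An odd Schauder projection maps
`K` into the symmetric convex hull of finitely many of its points, so that the energies stay at most
`c`, and moves every point little in `L¹`, hence, by the inequality above, in the Luxemburg norm.
Normalizing raises the energies to at most `(1 + κ) c`. The resulting odd map is continuous into
`W_0^{1,p(x)}` because its range is finite-dimensional, and odd continuous maps do not decrease the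
genus.
-/

namespace VarExp

variable {N : ℕ}

/-- The exponent `p` is measurable on the measurable set `Ω`, with values in `[1, b]`. -/
structure BoundedExponent (Ω : Set (Euc N)) (p : Euc N → ℝ) (b : ℝ) : Prop where
  measurableSet : MeasurableSet Ω
  aemeasurable : AEMeasurable p (volume.restrict Ω)
  one_le : ∀ x ∈ Ω, 1 ≤ p x
  le : ∀ x ∈ Ω, p x ≤ b

section Luxemburg

variable {F : Type*} [NormedAddCommGroup F] [NormedSpace ℝ F]
variable {Ω : Set (Euc N)} {p : Euc N → ℝ} {b : ℝ} {f g : Euc N → F}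

theorem luxNorm_le {γ : ℝ} (hγ : 0 < γ) (h : modular Ω p (fun x => γ⁻¹ • f x) ≤ 1) :
    luxNorm Ω p f ≤ ENNReal.ofReal γ :=
  iInf_le_of_le γ (iInf_le_of_le hγ (iInf_le_of_le h le_rfl))

namespace BoundedExponent

theorem modular_smul_le (hp : BoundedExponent Ω p b) {c : ℝ} (hc : ‖c‖ₑ ≤ 1) :
    modular Ω p (fun x => c • f x) ≤ ‖c‖ₑ * modular Ω p f := by
  rw [modular, modular, ← lintegral_const_mul' _ _ enorm_ne_top]
  refine setLIntegral_mono' hp.measurableSet fun x hx => ?_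
  have h1 := hp.one_le x hx
  rw [enorm_smul, ENNReal.mul_rpow_of_nonneg _ _ (by linarith)]
  gcongr
  simpa only [ENNReal.rpow_one] using ENNReal.rpow_le_rpow_of_exponent_ge hc h1

theorem modular_smul_le_rpow (hp : BoundedExponent Ω p b) {c : ℝ} {B : ℝ≥0} (hB : 1 ≤ B)
    (hc : ‖c‖ₑ ≤ B) : modular Ω p (fun x => c • f x) ≤ (B : ℝ≥0∞) ^ b * modular Ω p f := by
  have hB' : (1 : ℝ≥0∞) ≤ B := by exact_mod_cast hB
  have hBb : (B : ℝ≥0∞) ^ b ≠ ⊤ :=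
    ENNReal.rpow_ne_top_of_ne_zero (zero_lt_one.trans_le hB').ne' ENNReal.coe_ne_top
  rw [modular, modular, ← lintegral_const_mul' _ _ hBb]
  refine setLIntegral_mono' hp.measurableSet fun x hx => ?_
  have h0 : 0 ≤ p x := zero_le_one.trans (hp.one_le x hx)
  rw [enorm_smul, ENNReal.mul_rpow_of_nonneg _ _ h0]
  gcongr
  exact (ENNReal.rpow_le_rpow hc h0).trans (ENNReal.rpow_le_rpow_of_exponent_le hB' (hp.le x hx))

theorem luxNorm_zero (hp : BoundedExponent Ω p b) : luxNorm Ω p (fun _ => (0 : F)) = 0 := by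
  have hmod (γ : ℝ) : modular Ω p (fun _ => γ⁻¹ • (0 : F)) = 0 := by
    refine (setLIntegral_congr_fun hp.measurableSet fun x hx => ?_).trans lintegral_zero
    rw [smul_zero, enorm_zero, ENNReal.zero_rpow_of_pos (zero_lt_one.trans_le (hp.one_le x hx))]
  refine le_antisymm (ENNReal.le_of_forall_pos_le_add fun ε hε _ => ?_) bot_le
  rw [zero_add, ← ENNReal.ofReal_coe_nnreal]
  exact luxNorm_le (by exact_mod_cast hε) ((hmod ε).trans_le zero_le_one)

theorem luxNorm_smul_le (hp : BoundedExponent Ω p b) (c : ℝ) :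
    luxNorm Ω p (fun x => c • f x) ≤ ‖c‖ₑ * luxNorm Ω p f := by
  rcases eq_or_ne c 0 with rfl | hc
  · simp [hp.luxNorm_zero]
  simp only [luxNorm, ENNReal.mul_iInf_of_ne (enorm_ne_zero.2 hc) enorm_ne_top, le_iInf_iff]
  intro γ hγ h
  have hc0 : 0 < |c| := abs_pos.2 hc
  rw [Real.enorm_eq_ofReal_abs, ← ENNReal.ofReal_mul hc0.le]
  refine luxNorm_le (by positivity) (le_of_eq_of_le (modular_congr (ae_of_all _ fun x => ?_)) h)
  have hnorm : ‖(|c| * γ)⁻¹ * c‖ = ‖γ⁻¹‖ := by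
    rw [norm_mul, norm_inv, norm_mul, norm_inv, Real.norm_eq_abs |c|, abs_abs, Real.norm_eq_abs c]
    field_simp
  rw [smul_smul, enorm_smul, enorm_smul, enorm_eq_iff_norm_eq.2 hnorm]

theorem luxNorm_smul (hp : BoundedExponent Ω p b) (c : ℝ) :
    luxNorm Ω p (fun x => c • f x) = ‖c‖ₑ * luxNorm Ω p f := by
  rcases eq_or_ne c 0 with rfl | hc
  · simp [hp.luxNorm_zero]
  refine (hp.luxNorm_smul_le c).antisymm ?_
  have h := hp.luxNorm_smul_le (f := fun x => c • f x) c⁻¹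
  simp only [inv_smul_smul₀ hc] at h
  calc ‖c‖ₑ * luxNorm Ω p f ≤ ‖c‖ₑ * (‖c⁻¹‖ₑ * luxNorm Ω p fun x => c • f x) := by gcongr
    _ = luxNorm Ω p fun x => c • f x := by
      rw [enorm_inv hc, ← mul_assoc, ENNReal.mul_inv_cancel (enorm_ne_zero.2 hc) enorm_ne_top,
        one_mul]

theorem modular_le_of_luxNorm_lt (hp : BoundedExponent Ω p b) {B : ℝ≥0} (hB : 1 ≤ B)
    (h : luxNorm Ω p f < B) : modular Ω p f ≤ (B : ℝ≥0∞) ^ b := by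
  simp only [luxNorm, iInf_lt_iff] at h
  obtain ⟨γ, hγ, hmod, hγB⟩ := h
  have hscale := hp.modular_smul_le_rpow (f := fun x => γ⁻¹ • f x) (c := γ) hB
    ((Real.enorm_of_nonneg hγ.le).trans_le hγB.le)
  simp only [smul_inv_smul₀ hγ.ne'] at hscale
  exact hscale.trans (mul_le_of_le_one_right' hmod)

theorem luxNorm_lt_top_iff (hp : BoundedExponent Ω p b) :
    luxNorm Ω p f < ⊤ ↔ modular Ω p f < ⊤ := by
  constructor <;> intro h
  · lift luxNorm Ω p f to ℝ≥0 using h.ne with γ hγ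
    have hB : luxNorm Ω p f < (γ + 1 : ℝ≥0) := by
      rw [← hγ]
      exact_mod_cast lt_add_one γ
    refine (hp.modular_le_of_luxNorm_lt le_add_self hB).trans_lt ?_
    exact (ENNReal.rpow_ne_top_of_ne_zero (by simp) ENNReal.coe_ne_top).lt_top
  · set γ : ℝ := max 1 (modular Ω p f).toReal
    have hγ : 0 < γ := zero_lt_one.trans_le (le_max_left _ _)
    have hinv : ‖γ⁻¹‖ₑ = (ENNReal.ofReal γ)⁻¹ := by
      rw [enorm_inv hγ.ne', Real.enorm_of_nonneg hγ.le]
    refine (luxNorm_le hγ ((hp.modular_smul_le ?_).trans ?_)).trans_lt ENNReal.ofReal_lt_top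
    · rw [hinv, ENNReal.inv_le_one, ENNReal.one_le_ofReal]
      exact le_max_left _ _
    · rw [hinv, mul_comm, ← div_eq_mul_inv]
      refine ENNReal.div_le_of_le_mul ?_
      rw [one_mul, ← ENNReal.ofReal_toReal h.ne]
      exact ENNReal.ofReal_le_ofReal (le_max_right _ _)

theorem modular_add_le_one (hp : BoundedExponent Ω p b)
    (hf : AEStronglyMeasurable f (volume.restrict Ω)) {s t : ℝ} (hs : 0 < s) (ht : 0 < t)
    (hfs : modular Ω p (fun x => s⁻¹ • f x) ≤ 1) (hgt : modular Ω p (fun x => t⁻¹ • g x) ≤ 1) :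
    modular Ω p (fun x => (s + t)⁻¹ • (f x + g x)) ≤ 1 := by
  set v := s / (s + t)
  set w := t / (s + t)
  have hv : 0 ≤ v := by positivity
  have hw : 0 ≤ w := by positivity
  have hvw : ENNReal.ofReal v + ENNReal.ofReal w = 1 := by
    rw [← ENNReal.ofReal_add hv hw, ← add_div, div_self (by positivity), ENNReal.ofReal_one]
  have hcomb (x : Euc N) :
      (s + t)⁻¹ • (f x + g x) = v • s⁻¹ • f x + w • t⁻¹ • g x := by
    simp only [smul_add, smul_smul, v, w]
    congr 2 <;> field_simp
  have hconvex : ∀ x ∈ Ω, ‖(s + t)⁻¹ • (f x + g x)‖ₑ ^ p x ≤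
      ENNReal.ofReal v * ‖s⁻¹ • f x‖ₑ ^ p x + ENNReal.ofReal w * ‖t⁻¹ • g x‖ₑ ^ p x := by
    intro x hx
    have hx1 := hp.one_le x hx
    refine le_trans ?_ (ENNReal.rpow_arith_mean_le_arith_mean2_rpow _ _ _ _ hvw hx1)
    refine ENNReal.rpow_le_rpow ?_ (by linarith)
    rw [← Real.enorm_of_nonneg hv, ← Real.enorm_of_nonneg hw, ← enorm_smul, ← enorm_smul, hcomb]
    exact enorm_add_le _ _
  refine (setLIntegral_mono' hp.measurableSet hconvex).trans ?_
  have hmeas : AEMeasurable (fun x => ‖s⁻¹ • f x‖ₑ ^ p x) (volume.restrict Ω) :=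
    (hf.const_smul s⁻¹).enorm.pow hp.aemeasurable
  rw [lintegral_add_left' (hmeas.const_mul _),
    lintegral_const_mul' _ _ ENNReal.ofReal_ne_top, lintegral_const_mul' _ _ ENNReal.ofReal_ne_top,
    ← hvw]
  exact add_le_add (mul_le_of_le_one_right' hfs) (mul_le_of_le_one_right' hgt)

theorem luxNorm_add_le (hp : BoundedExponent Ω p b)
    (hf : AEStronglyMeasurable f (volume.restrict Ω)) :
    luxNorm Ω p (fun x => f x + g x) ≤ luxNorm Ω p f + luxNorm Ω p g := by
  rw [luxNorm.eq_1 Ω p f, luxNorm.eq_1 Ω p g]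
  simp only [ENNReal.iInf_add, ENNReal.add_iInf, le_iInf_iff]
  intro t ht hgt s hs hfs
  rw [← ENNReal.ofReal_add hs.le ht.le]
  exact luxNorm_le (add_pos hs ht) (hp.modular_add_le_one hf hs ht hfs hgt)

theorem lintegral_enorm_le (hp : BoundedExponent Ω p b) (hΩ : volume Ω ≠ ⊤) :
    ∫⁻ x in Ω, ‖f x‖ₑ ≤ (volume Ω + 1) * luxNorm Ω p f := by
  have h0 : volume Ω + 1 ≠ 0 := by simp
  have htop : volume Ω + 1 ≠ ⊤ := ENNReal.add_ne_top.2 ⟨hΩ, ENNReal.one_ne_top⟩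
  simp only [luxNorm, ENNReal.mul_iInf_of_ne h0 htop, le_iInf_iff]
  intro γ hγ h
  have hpoint : ∀ x ∈ Ω, ‖f x‖ₑ ≤ ENNReal.ofReal γ * (1 + ‖γ⁻¹ • f x‖ₑ ^ p x) := by
    intro x hx
    have hf : ‖f x‖ₑ = ENNReal.ofReal γ * ‖γ⁻¹ • f x‖ₑ := by
      rw [← Real.enorm_of_nonneg hγ.le, ← enorm_smul, smul_inv_smul₀ hγ.ne']
    rw [hf]
    gcongr
    rcases le_total ‖γ⁻¹ • f x‖ₑ 1 with h1 | h1
    · exact h1.trans le_self_add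
    · refine le_trans ?_ le_add_self
      simpa only [ENNReal.rpow_one] using ENNReal.rpow_le_rpow_of_exponent_le h1 (hp.one_le x hx)
  calc ∫⁻ x in Ω, ‖f x‖ₑ
      ≤ ∫⁻ x in Ω, ENNReal.ofReal γ * (1 + ‖γ⁻¹ • f x‖ₑ ^ p x) :=
        setLIntegral_mono' hp.measurableSet hpoint
    _ = ENNReal.ofReal γ * (volume Ω + modular Ω p (fun x => γ⁻¹ • f x)) := by
        rw [lintegral_const_mul' _ _ ENNReal.ofReal_ne_top, lintegral_add_left measurable_const,
          setLIntegral_one, modular]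
    _ ≤ (volume Ω + 1) * ENNReal.ofReal γ := by
        rw [mul_comm]
        gcongr

end BoundedExponent

end Luxemburg

section ExtSeminorm

/-- A seminorm allowed to take the value `∞`; homogeneity is read with `0 * ∞ = 0`. This is the
common structure of `ℰ_{p(x)}` and of the Luxemburg norm on `L¹(Ω)`. -/
structure IsExtSeminorm {V : Type*} [AddCommGroup V] [Module ℝ V] (E : V → ℝ≥0∞) : Prop where
  add_le : ∀ u v, E (u + v) ≤ E u + E v
  smul : ∀ (c : ℝ) u, E (c • u) = ‖c‖ₑ * E u

namespace IsExtSeminorm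

variable {V : Type*} [AddCommGroup V] [Module ℝ V] {E : V → ℝ≥0∞} (hE : IsExtSeminorm E)
include hE

theorem neg (u : V) : E (-u) = E u := by
  simpa using hE.smul (-1) u

theorem nnreal_smul (t : ℝ≥0) (u : V) : E ((t : ℝ) • u) = t * E u := by
  rw [hE.smul, Real.enorm_of_nonneg t.coe_nonneg, ENNReal.ofReal_coe_nnreal]

theorem sub_le (u v : V) : E (u - v) ≤ E u + E v := by
  rw [sub_eq_add_neg, ← hE.neg v]
  exact hE.add_le u (-v)

theorem le_add_sub (u v : V) : E u ≤ E v + E (u - v) := by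
  simpa only [add_sub_cancel] using hE.add_le v (u - v)

theorem convexOn : ConvexOn ℝ≥0 univ E := by
  refine ⟨convex_univ, fun u _ v _ s t _ _ _ => (hE.add_le _ _).trans_eq ?_⟩
  exact congrArg₂ (· + ·) (hE.nnreal_smul s u) (hE.nnreal_smul t v)

theorem sum_smul_le {ι : Type*} (s : Finset ι) (c : ι → ℝ) (u : ι → V) :
    E (∑ i ∈ s, c i • u i) ≤ ∑ i ∈ s, ‖c i‖ₑ * E (u i) := by
  have hzero : E 0 = 0 := by simpa using hE.smul 0 0
  refine (Finset.le_sum_of_subadditive E hzero.le hE.add_le s _).trans_eq ?_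
  simp only [hE.smul]

variable {X : Type*} [TopologicalSpace X] {K : Set X} {t : Finset V} {c : V → X → ℝ}

theorem tendsto_sum_smul_sub (ht : ∀ w ∈ t, E w ≠ ⊤) (hc : ∀ w, ContinuousOn (c w) K) {x₀ : X}
    (hx₀ : x₀ ∈ K) :
    Filter.Tendsto (fun x => E (∑ w ∈ t, c w x • w - ∑ w ∈ t, c w x₀ • w))
      (nhdsWithin x₀ K) (nhds 0) := by
  have hbound : Filter.Tendsto (fun x => ∑ w ∈ t, ‖c w x - c w x₀‖ₑ * E w)
      (nhdsWithin x₀ K) (nhds (∑ w ∈ t, ‖c w x₀ - c w x₀‖ₑ * E w)) := by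
    refine tendsto_finsetSum _ fun w hw => ENNReal.Tendsto.mul_const ?_ (Or.inr (ht w hw))
    exact (((hc w) x₀ hx₀).sub tendsto_const_nhds).enorm
  simp only [sub_self, enorm_zero, zero_mul, Finset.sum_const_zero] at hbound
  refine tendsto_of_tendsto_of_tendsto_of_le_of_le tendsto_const_nhds hbound (fun _ => bot_le)
    fun x => ?_
  simp only [← Finset.sum_sub_distrib, ← sub_smul]
  exact hE.sum_smul_le t (fun w => c w x - c w x₀) id

theorem continuousOn_sum_smul (ht : ∀ w ∈ t, E w ≠ ⊤) (hc : ∀ w, ContinuousOn (c w) K) :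
    ContinuousOn (fun x => E (∑ w ∈ t, c w x • w)) K := by
  intro x₀ hx₀
  have hdiff := hE.tendsto_sum_smul_sub ht hc hx₀
  refine tendsto_of_tendsto_of_tendsto_of_le_of_le
    (by simpa only [tsub_zero] using
      ENNReal.Tendsto.sub tendsto_const_nhds hdiff (Or.inr ENNReal.zero_ne_top))
    (by simpa only [add_zero] using tendsto_const_nhds.add hdiff)
    (fun x => tsub_le_iff_right.2 ?_) fun x => hE.le_add_sub _ _
  rw [← hE.neg (_ - _), neg_sub]
  exact hE.le_add_sub _ _

end IsExtSeminorm

end ExtSeminorm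

section WeakGradient

variable {Ω : Set (Euc N)} {p : Euc N → ℝ} {b : ℝ}

theorem gradient_fun_add {φ ψ : Euc N → ℝ} {x : Euc N} (hφ : DifferentiableAt ℝ φ x)
    (hψ : DifferentiableAt ℝ ψ x) :
    gradient (fun y => φ y + ψ y) x = gradient φ x + gradient ψ x := by
  rw [gradient, gradient, gradient, fderiv_fun_add hφ hψ, map_add]

theorem gradient_fun_const_smul {φ : Euc N → ℝ} {x : Euc N} (hφ : DifferentiableAt ℝ φ x) (c : ℝ) :
    gradient (fun y => c • φ y) x = c • gradient φ x := by
  rw [gradient, gradient, fderiv_fun_const_smul hφ, map_smul]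

theorem enorm_gradient (φ : Euc N → ℝ) (x : Euc N) : ‖gradient φ x‖ₑ = ‖fderiv ℝ φ x‖ₑ :=
  LinearIsometryEquiv.enorm_map _ _

namespace IsTestFunction

variable {φ ψ : Euc N → ℝ}

theorem differentiable (h : IsTestFunction Ω φ) : Differentiable ℝ φ :=
  h.1.differentiable (by simp)

theorem continuous_gradient (h : IsTestFunction Ω φ) : Continuous (gradient φ) :=
  (InnerProductSpace.toDual ℝ (Euc N)).symm.continuous.comp (h.1.continuous_fderiv (by simp))

theorem zero : IsTestFunction Ω (fun _ => 0) :=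
  ⟨contDiff_const, HasCompactSupport.zero, by simp⟩

theorem add (h : IsTestFunction Ω φ) (h' : IsTestFunction Ω ψ) :
    IsTestFunction Ω (fun x => φ x + ψ x) :=
  ⟨h.1.add h'.1, h.2.1.add h'.2.1, (tsupport_add φ ψ).trans (union_subset h.2.2 h'.2.2)⟩

theorem const_smul (h : IsTestFunction Ω φ) (c : ℝ) : IsTestFunction Ω (fun x => c • φ x) :=
  ⟨h.1.const_smul c, h.2.1.smul_left (f := fun _ => c),
    (tsupport_smul_subset_right (fun _ => c) φ).trans h.2.2⟩

end IsTestFunction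

namespace IsWeakGrad

variable {u v : Euc N → ℝ} {G H : Euc N → Euc N}

theorem integrableOn_smul_gradient (h : IsWeakGrad Ω u G) {φ : Euc N → ℝ}
    (hφ : IsTestFunction Ω φ) : IntegrableOn (fun x => u x • gradient φ x) Ω := by
  have hK : IntegrableOn (fun x => u x • gradient φ x) (tsupport φ) :=
    (h.1.integrableOn_compact_subset hφ.2.2 hφ.2.1).smul_continuousOn
      hφ.continuous_gradient.continuousOn hφ.2.1
  refine (hK.integrable_of_forall_notMem_eq_zero fun x hx => ?_).integrableOn
  have hfderiv : fderiv ℝ φ x = 0 :=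
    image_eq_zero_of_notMem_tsupport fun hx' => hx (tsupport_fderiv_subset ℝ hx')
  rw [gradient, hfderiv, map_zero, smul_zero]

theorem integrableOn_smul (h : IsWeakGrad Ω u G) {φ : Euc N → ℝ}
    (hφ : IsTestFunction Ω φ) : IntegrableOn (fun x => φ x • G x) Ω := by
  have hK : IntegrableOn (fun x => φ x • G x) (tsupport φ) :=
    (h.2.1.integrableOn_compact_subset hφ.2.2 hφ.2.1).continuousOn_smul
      hφ.1.continuous.continuousOn hφ.2.1
  refine (hK.integrable_of_forall_notMem_eq_zero fun x hx => ?_).integrableOn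
  rw [image_eq_zero_of_notMem_tsupport hx, zero_smul]

theorem ae_eq (hΩ : IsOpen Ω) (h : IsWeakGrad Ω u G) (h' : IsWeakGrad Ω u H) :
    G =ᵐ[volume.restrict Ω] H := by
  have hzero : ∀ᵐ x, x ∈ Ω → G x - H x = 0 := by
    refine hΩ.ae_eq_zero_of_integral_contDiff_smul_eq_zero (h.2.1.sub h'.2.1) fun φ h1 h2 h3 => ?_
    have hφ : IsTestFunction Ω φ := ⟨h1, h2, h3⟩
    have hGH := (h.2.2 φ hφ).symm.trans (h'.2.2 φ hφ)
    rw [← setIntegral_eq_integral_of_forall_compl_eq_zero (s := Ω) fun x hx => ?_]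
    · simp only [smul_sub]
      rw [integral_sub (h.integrableOn_smul hφ) (h'.integrableOn_smul hφ), neg_inj.1 hGH, sub_self]
    · rw [image_eq_zero_of_notMem_tsupport fun hx' => hx (h3 hx'), zero_smul]
  rw [Filter.EventuallyEq, ae_restrict_iff' hΩ.measurableSet]
  exact hzero.mono fun x hx hxΩ => sub_eq_zero.1 (hx hxΩ)

theorem add (h : IsWeakGrad Ω u G) (h' : IsWeakGrad Ω v H) :
    IsWeakGrad Ω (fun x => u x + v x) (fun x => G x + H x) := by
  refine ⟨h.1.add h'.1, h.2.1.add h'.2.1, fun φ hφ => ?_⟩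
  simp only [add_smul, smul_add]
  rw [integral_add (h.integrableOn_smul_gradient hφ) (h'.integrableOn_smul_gradient hφ),
    integral_add (h.integrableOn_smul hφ) (h'.integrableOn_smul hφ), h.2.2 φ hφ, h'.2.2 φ hφ,
    neg_add]

theorem const_smul (h : IsWeakGrad Ω u G) (c : ℝ) :
    IsWeakGrad Ω (fun x => c • u x) (fun x => c • G x) := by
  refine ⟨h.1.smul c, h.2.1.smul c, fun φ hφ => ?_⟩
  simp only [smul_assoc, smul_comm _ c (_ : Euc N)]
  rw [integral_smul, integral_smul, h.2.2 φ hφ, smul_neg]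

theorem congr (h : IsWeakGrad Ω u G) (huv : u =ᵐ[volume.restrict Ω] v) : IsWeakGrad Ω v G :=
  ⟨h.1.congr huv, h.2.1, fun φ hφ => (integral_congr_ae (huv.mono fun x hx => by
    simp only [hx])).symm.trans (h.2.2 φ hφ)⟩

end IsWeakGrad

namespace MemLpx

variable {F : Type*} [NormedAddCommGroup F] {f g : Euc N → F}

theorem congr (h : MemLpx Ω p f) (hfg : f =ᵐ[volume.restrict Ω] g) : MemLpx Ω p g :=
  ⟨h.1.congr hfg, (modular_congr (hfg.mono fun x hx => by rw [hx])).symm.trans_lt h.2⟩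

variable [NormedSpace ℝ F]

theorem zero (hp : BoundedExponent Ω p b) : MemLpx Ω p (fun _ => (0 : F)) :=
  ⟨aestronglyMeasurable_const,
    hp.luxNorm_lt_top_iff.1 (hp.luxNorm_zero.trans_lt ENNReal.zero_lt_top)⟩

theorem add (hp : BoundedExponent Ω p b) (hf : MemLpx Ω p f) (hg : MemLpx Ω p g) :
    MemLpx Ω p (fun x => f x + g x) :=
  ⟨hf.1.add hg.1, hp.luxNorm_lt_top_iff.1 <| (hp.luxNorm_add_le hf.1).trans_lt <|
    ENNReal.add_lt_top.2 ⟨hp.luxNorm_lt_top_iff.2 hf.2, hp.luxNorm_lt_top_iff.2 hg.2⟩⟩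

theorem const_smul (hp : BoundedExponent Ω p b) (hf : MemLpx Ω p f) (c : ℝ) :
    MemLpx Ω p (fun x => c • f x) :=
  ⟨hf.1.const_smul c, hp.luxNorm_lt_top_iff.1 <| (hp.luxNorm_smul c).trans_lt <|
    ENNReal.mul_lt_top enorm_lt_top (hp.luxNorm_lt_top_iff.2 hf.2)⟩

end MemLpx

/-- `u` belongs to `W_0^{1,p(x)}(Ω)` and `G` is its distributional gradient. -/
structure HasW0Grad (Ω : Set (Euc N)) (p : Euc N → ℝ) (u : Euc N → ℝ) (G : Euc N → Euc N) :
    Prop where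
  memLpx : MemLpx Ω p u
  isWeakGrad : IsWeakGrad Ω u G
  memLpx_grad : MemLpx Ω p G
  approx : ∀ ε : ℝ≥0∞, 0 < ε → ∃ φ : Euc N → ℝ, IsTestFunction Ω φ ∧
      luxNorm Ω p (fun x => u x - φ x) + luxNorm Ω p (fun x => G x - gradient φ x) < ε

theorem memW0_iff_exists_hasW0Grad {u : Euc N → ℝ} : MemW0 Ω p u ↔ ∃ G, HasW0Grad Ω p u G :=
  ⟨fun ⟨h, G, h1, h2, h3⟩ => ⟨G, h, h1, h2, h3⟩, fun ⟨G, h, h1, h2, h3⟩ => ⟨h, G, h1, h2, h3⟩⟩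

namespace HasW0Grad

variable {u v : Euc N → ℝ} {G H : Euc N → Euc N}

theorem zero (hp : BoundedExponent Ω p b) : HasW0Grad Ω p (fun _ => 0) (fun _ => 0) where
  memLpx := .zero hp
  isWeakGrad := ⟨locallyIntegrableOn_zero, locallyIntegrableOn_zero, by simp⟩
  memLpx_grad := .zero hp
  approx ε hε := ⟨fun _ => 0, .zero, by simpa [hp.luxNorm_zero] using hε⟩

theorem add (hp : BoundedExponent Ω p b) (h : HasW0Grad Ω p u G) (h' : HasW0Grad Ω p v H) :
    HasW0Grad Ω p (fun x => u x + v x) (fun x => G x + H x) where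
  memLpx := h.memLpx.add hp h'.memLpx
  isWeakGrad := h.isWeakGrad.add h'.isWeakGrad
  memLpx_grad := h.memLpx_grad.add hp h'.memLpx_grad
  approx ε hε := by
    obtain ⟨φ, hφ, hlt⟩ := h.approx (ε / 2) (ENNReal.half_pos hε.ne')
    obtain ⟨ψ, hψ, hlt'⟩ := h'.approx (ε / 2) (ENNReal.half_pos hε.ne')
    refine ⟨_, hφ.add hψ, ?_⟩
    simp only [gradient_fun_add (hφ.differentiable _) (hψ.differentiable _), add_sub_add_comm]
    refine (add_le_add (hp.luxNorm_add_le (h.memLpx.1.sub hφ.1.continuous.aestronglyMeasurable))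
      (hp.luxNorm_add_le
        (h.memLpx_grad.1.sub hφ.continuous_gradient.aestronglyMeasurable))).trans_lt ?_
    rw [add_add_add_comm]
    exact (ENNReal.add_lt_add hlt hlt').trans_eq (ENNReal.add_halves ε)

theorem const_smul (hp : BoundedExponent Ω p b) (h : HasW0Grad Ω p u G) (c : ℝ) :
    HasW0Grad Ω p (fun x => c • u x) (fun x => c • G x) where
  memLpx := h.memLpx.const_smul hp c
  isWeakGrad := h.isWeakGrad.const_smul c
  memLpx_grad := h.memLpx_grad.const_smul hp c
  approx ε hε := by
    obtain ⟨φ, hφ, hlt⟩ := h.approx (ε / (‖c‖ₑ + 1)) (ENNReal.div_pos hε.ne' (by simp))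
    refine ⟨_, hφ.const_smul c, ?_⟩
    simp only [gradient_fun_const_smul (hφ.differentiable _), ← smul_sub]
    rw [hp.luxNorm_smul, hp.luxNorm_smul, ← mul_add]
    exact (mul_le_mul_left le_self_add _).trans_lt (ENNReal.mul_lt_of_lt_div' hlt)

theorem congr (h : HasW0Grad Ω p u G) (huv : u =ᵐ[volume.restrict Ω] v) :
    HasW0Grad Ω p v G where
  memLpx := h.memLpx.congr huv
  isWeakGrad := h.isWeakGrad.congr huv
  memLpx_grad := h.memLpx_grad
  approx ε hε := by
    obtain ⟨φ, hφ, hlt⟩ := h.approx ε hε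
    refine ⟨φ, hφ, ?_⟩
    rwa [← luxNorm_congr (f := fun x => u x - φ x) (huv.mono fun x hx => by simp only [hx])]

theorem gradNorm_eq (hΩ : IsOpen Ω) {u : L1 Ω} (h : HasW0Grad Ω p u G) :
    gradNorm Ω p u = luxNorm Ω p G := by
  have hex : ∃ G, IsWeakGrad Ω u G := ⟨G, h.isWeakGrad⟩
  rw [gradNorm, weakGrad, dif_pos hex]
  exact luxNorm_congr ((hex.choose_spec.ae_eq hΩ h.isWeakGrad).mono fun x hx => by rw [hx])

theorem energy_eq (hΩ : IsOpen Ω) {u : L1 Ω} (h : HasW0Grad Ω p u G) :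
    energy Ω p u = luxNorm Ω p G := by
  rw [energy, if_pos (memW0_iff_exists_hasW0Grad.2 ⟨G, h⟩), h.gradNorm_eq hΩ]

end HasW0Grad

theorem energy_eq_top {u : L1 Ω} (h : ¬MemW0 Ω p u) : energy Ω p u = ⊤ :=
  if_neg h

theorem energy_eq_gradNorm {u : L1 Ω} (h : MemW0 Ω p u) : energy Ω p u = gradNorm Ω p u :=
  if_pos h

namespace BoundedExponent

variable {u : L1 Ω}

theorem energy_add_le (hp : BoundedExponent Ω p b) (hΩ : IsOpen Ω) (u v : L1 Ω) :
    energy Ω p (u + v) ≤ energy Ω p u + energy Ω p v := by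
  by_cases hu : MemW0 Ω p u
  swap
  · rw [energy_eq_top hu, top_add]
    exact le_top
  by_cases hv : MemW0 Ω p v
  swap
  · rw [energy_eq_top hv, add_top]
    exact le_top
  obtain ⟨G, hG⟩ := memW0_iff_exists_hasW0Grad.1 hu
  obtain ⟨H, hH⟩ := memW0_iff_exists_hasW0Grad.1 hv
  rw [hG.energy_eq hΩ, hH.energy_eq hΩ,
    ((hG.add hp hH).congr (Lp.coeFn_add u v).symm).energy_eq hΩ]
  exact hp.luxNorm_add_le hG.memLpx_grad.1

theorem energy_zero (hp : BoundedExponent Ω p b) (hΩ : IsOpen Ω) :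
    energy Ω p (0 : L1 Ω) = 0 := by
  rw [((HasW0Grad.zero hp).congr (Lp.coeFn_zero ℝ 1 _).symm).energy_eq hΩ, hp.luxNorm_zero]

theorem energy_smul (hp : BoundedExponent Ω p b) (hΩ : IsOpen Ω) (c : ℝ) (u : L1 Ω) :
    energy Ω p (c • u) = ‖c‖ₑ * energy Ω p u := by
  rcases eq_or_ne c 0 with rfl | hc
  · simp [hp.energy_zero hΩ]
  have hmem {c : ℝ} {u : L1 Ω} {G : Euc N → Euc N} (h : HasW0Grad Ω p u G) :
      HasW0Grad Ω p (c • u : L1 Ω) fun x => c • G x :=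
    (h.const_smul hp c).congr (Lp.coeFn_smul c u).symm
  by_cases hu : MemW0 Ω p u
  · obtain ⟨G, hG⟩ := memW0_iff_exists_hasW0Grad.1 hu
    rw [hG.energy_eq hΩ, (hmem hG).energy_eq hΩ, hp.luxNorm_smul]
  · have hcu : ¬MemW0 Ω p (c • u : L1 Ω) := fun h => hu <| by
      obtain ⟨G, hG⟩ := memW0_iff_exists_hasW0Grad.1 h
      have hinv := memW0_iff_exists_hasW0Grad.2 ⟨_, hmem (c := c⁻¹) hG⟩
      rwa [inv_smul_smul₀ hc] at hinv
    rw [energy_eq_top hu, energy_eq_top hcu, ENNReal.mul_top (enorm_ne_zero.2 hc)]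

theorem isExtSeminorm_energy (hp : BoundedExponent Ω p b) (hΩ : IsOpen Ω) :
    IsExtSeminorm (energy Ω p) :=
  ⟨hp.energy_add_le hΩ, hp.energy_smul hΩ⟩

theorem memW0_iff_energy_ne_top (hp : BoundedExponent Ω p b) (hΩ : IsOpen Ω) :
    MemW0 Ω p u ↔ energy Ω p u ≠ ⊤ := by
  refine ⟨fun h => ?_, not_imp_comm.1 energy_eq_top⟩
  obtain ⟨G, hG⟩ := memW0_iff_exists_hasW0Grad.1 h
  rw [hG.energy_eq hΩ]
  exact (hp.luxNorm_lt_top_iff.2 hG.memLpx_grad.2).ne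

theorem isExtSeminorm_luxNorm (hp : BoundedExponent Ω p b) :
    IsExtSeminorm fun u : L1 Ω => luxNorm Ω p u where
  add_le u v := le_of_eq_of_le (luxNorm_congr ((Lp.coeFn_add u v).mono fun x hx => by
    rw [hx, Pi.add_apply])) (hp.luxNorm_add_le (Lp.aestronglyMeasurable u))
  smul c u := (luxNorm_congr ((Lp.coeFn_smul c u).mono fun x hx => by
    rw [hx, Pi.smul_apply])).trans (hp.luxNorm_smul c)

theorem gFun_eq_one_iff (hp : BoundedExponent Ω p b) :
    gFun Ω p u = 1 ↔ luxNorm Ω p u = 1 := by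
  rw [gFun]
  constructor
  · intro h
    split_ifs at h with hu
    · rw [← ENNReal.coe_toNNReal (hp.luxNorm_lt_top_iff.2 hu.2).ne, h, ENNReal.coe_one]
    · exact absurd h zero_ne_one
  · intro h
    have hu : MemLpx Ω p u :=
      ⟨Lp.aestronglyMeasurable u, hp.luxNorm_lt_top_iff.1 (h.trans_lt ENNReal.one_lt_top)⟩
    rw [if_pos hu, h, ENNReal.toNNReal_one]

end BoundedExponent

end WeakGradient

section Poincare

variable {Ω : Set (Euc N)} {p : Euc N → ℝ} {b : ℝ} {u : Euc N → ℝ} {G : Euc N → Euc N}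

theorem le_of_forall_pos_le_add_mul {a c : ℝ≥0∞} (K : ℝ≥0)
    (h : ∀ κ : ℝ≥0, 0 < κ → a ≤ c + K * κ) : a ≤ c := by
  refine ENNReal.le_of_forall_pos_le_add fun ε hε _ => (h (ε / (K + 1)) (by positivity)).trans ?_
  gcongr
  norm_cast
  rw [mul_div_assoc', div_le_iff₀ (by positivity), mul_comm]
  gcongr
  exact le_self_add

theorem lintegral_enorm_le_add_sub {F : Type*} [NormedAddCommGroup F] {μ : Measure (Euc N)}
    {f g : Euc N → F} (hg : AEStronglyMeasurable g μ) :
    ∫⁻ x, ‖f x‖ₑ ∂μ ≤ ∫⁻ x, ‖g x‖ₑ ∂μ + ∫⁻ x, ‖f x - g x‖ₑ ∂μ := by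
  rw [← lintegral_add_left' hg.enorm]
  refine lintegral_mono fun x => ?_
  simpa only [add_sub_cancel] using enorm_add_le (g x) (f x - g x)

theorem BoundedExponent.luxNorm_le_add_sub {F : Type*} [NormedAddCommGroup F] [NormedSpace ℝ F]
    (hp : BoundedExponent Ω p b) {f g : Euc N → F}
    (hg : AEStronglyMeasurable g (volume.restrict Ω)) :
    luxNorm Ω p f ≤ luxNorm Ω p g + luxNorm Ω p (fun x => f x - g x) := by
  simpa only [add_sub_cancel] using hp.luxNorm_add_le (f := g) (g := fun x => f x - g x) hg

theorem HasW0Grad.exists_isTestFunction_approx (hp : BoundedExponent Ω p b)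
    (hΩ : volume Ω ≠ ⊤) (h : HasW0Grad Ω p u G) {κ : ℝ≥0} (hκ : 0 < κ) :
    ∃ φ, IsTestFunction Ω φ ∧ luxNorm Ω p u ≤ luxNorm Ω p φ + κ ∧
      luxNorm Ω p (gradient φ) ≤ luxNorm Ω p G + κ ∧
      ∫⁻ x in Ω, ‖u x‖ₑ ≤ (∫⁻ x in Ω, ‖φ x‖ₑ) + κ ∧
      ∫⁻ x in Ω, ‖φ x‖ₑ ≤ (∫⁻ x in Ω, ‖u x‖ₑ) + κ := by
  have hV : volume Ω + 1 ≠ ⊤ := ENNReal.add_ne_top.2 ⟨hΩ, ENNReal.one_ne_top⟩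
  obtain ⟨φ, hφ, hlt⟩ := h.approx (κ / (volume Ω + 1))
    (ENNReal.div_pos (by exact_mod_cast hκ.ne') hV)
  have hmul : (volume Ω + 1) * (luxNorm Ω p (fun x => u x - φ x) +
      luxNorm Ω p fun x => G x - gradient φ x) ≤ κ :=
    (ENNReal.mul_lt_of_lt_div' hlt).le
  have hle : luxNorm Ω p (fun x => u x - φ x) +
      luxNorm Ω p (fun x => G x - gradient φ x) ≤ κ :=
    (le_mul_of_one_le_left' le_add_self).trans hmul
  have hint : ∫⁻ x in Ω, ‖u x - φ x‖ₑ ≤ κ :=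
    (hp.lintegral_enorm_le hΩ).trans ((mul_le_mul_right le_self_add _).trans hmul)
  refine ⟨φ, hφ, ?_, ?_, ?_, ?_⟩
  · exact (hp.luxNorm_le_add_sub hφ.1.continuous.aestronglyMeasurable).trans
      (add_le_add_right (le_self_add.trans hle) _)
  · refine (hp.luxNorm_le_add_sub h.memLpx_grad.1).trans (add_le_add_right ?_ _)
    rw [luxNorm_congr (ae_of_all _ fun x => enorm_sub_rev (gradient φ x) (G x))]
    exact le_add_self.trans hle
  · exact (lintegral_enorm_le_add_sub hφ.1.continuous.aestronglyMeasurable).trans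
      (add_le_add_right hint _)
  · refine (lintegral_enorm_le_add_sub h.memLpx.1).trans (add_le_add_right ?_ _)
    simpa only [enorm_sub_rev] using hint

theorem exists_lintegral_le_lintegral_gradient (hN : 2 ≤ N) (hΩ : Bornology.IsBounded Ω) :
    ∃ C : ℝ≥0, ∀ φ : Euc N → ℝ, IsTestFunction Ω φ →
      ∫⁻ x in Ω, ‖φ x‖ₑ ≤ C * ∫⁻ x in Ω, ‖gradient φ x‖ₑ := by
  refine ⟨eLpNormLESNormFDerivOfLeConst ℝ (volume : Measure (Euc N)) Ω 1 1, fun φ hφ => ?_⟩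
  have hsupp : Function.support φ ⊆ Ω := (subset_tsupport φ).trans hφ.2.2
  have hsupp' : Function.support (fun x => ‖fderiv ℝ φ x‖ₑ) ⊆ Ω :=
    (Function.support_comp_subset enorm_zero (fderiv ℝ φ)).trans
      ((support_fderiv_subset ℝ).trans hφ.2.2)
  have hsob := eLpNorm_le_eLpNorm_fderiv (volume : Measure (Euc N)) (hφ.1.of_le (by simp)) hsupp
    (p := 1) le_rfl (by rw [finrank_euclideanSpace_fin]; exact_mod_cast hN) hΩ
  simp only [ENNReal.coe_one, eLpNorm_one_eq_lintegral_enorm] at hsob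
  simp only [enorm_gradient]
  rw [setLIntegral_eq_of_support_subset hsupp']
  exact (setLIntegral_le_lintegral _ _).trans hsob

theorem BoundedExponent.exists_lintegral_le_luxNorm_gradient (hp : BoundedExponent Ω p b)
    (hN : 2 ≤ N) (hΩ : Bornology.IsBounded Ω) :
    ∃ C : ℝ≥0, ∀ u G, HasW0Grad Ω p u G → ∫⁻ x in Ω, ‖u x‖ₑ ≤ C * luxNorm Ω p G := by
  obtain ⟨C, hC⟩ := exists_lintegral_le_lintegral_gradient hN hΩ
  have hV : volume Ω ≠ ⊤ := hΩ.measure_lt_top.ne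
  lift volume Ω to ℝ≥0 using hV with V hVΩ
  refine ⟨C * (V + 1), fun u G h => le_of_forall_pos_le_add_mul (C * (V + 1) + 1) fun κ hκ => ?_⟩
  obtain ⟨φ, hφ, -, hgrad, hint, -⟩ := h.exists_isTestFunction_approx hp (by simp [← hVΩ]) hκ
  calc ∫⁻ x in Ω, ‖u x‖ₑ
      ≤ (∫⁻ x in Ω, ‖φ x‖ₑ) + κ := hint
    _ ≤ C * (∫⁻ x in Ω, ‖gradient φ x‖ₑ) + κ := by gcongr; exact hC φ hφ
    _ ≤ C * ((V + 1) * luxNorm Ω p (gradient φ)) + κ := by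
        gcongr
        rw [hVΩ]
        exact hp.lintegral_enorm_le (by simp [← hVΩ])
    _ ≤ C * ((V + 1) * (luxNorm Ω p G + κ)) + κ := by gcongr
    _ = _ := by push_cast; ring

end Poincare

section Sobolev

variable {Ω : Set (Euc N)} {p : Euc N → ℝ} {b : ℝ} {φ ψ : Euc N → ℝ}

theorem exists_sobolev_exponents {n t : ℝ} (hn : 1 < n) (ht : 1 ≤ t) :
    ∃ r q : ℝ≥0, 1 ≤ r ∧ r < n ∧ (r : ℝ)⁻¹ - n⁻¹ ≤ (q : ℝ)⁻¹ ∧ (r = 1 ∨ r < t) ∧ t < q := by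
  have hn0 : 0 < n := zero_lt_one.trans hn
  have ht0 : 0 < t := zero_lt_one.trans_le ht
  obtain ⟨r, hr1, hrn, hrt, hsob⟩ :
      ∃ r : ℝ, 1 ≤ r ∧ r < n ∧ (r = 1 ∨ r < t) ∧ r⁻¹ - n⁻¹ < t⁻¹ := by
    rcases ht.eq_or_lt with rfl | ht1
    · exact ⟨1, le_rfl, hn, .inl rfl, by simpa using hn0⟩
    · have hlt : max 1 (t⁻¹ + n⁻¹)⁻¹ < min t n := by
        refine max_lt (lt_min ht1 hn) (lt_min ?_ ?_)
        · exact inv_lt_of_inv_lt₀ ht0 (by simpa using hn0)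
        · exact inv_lt_of_inv_lt₀ hn0 (by simpa using ht0)
      obtain ⟨r, hlr, hrm⟩ := exists_between hlt
      refine ⟨r, ((le_max_left _ _).trans_lt hlr).le, hrm.trans_le (min_le_right _ _),
        .inr (hrm.trans_le (min_le_left _ _)), ?_⟩
      linarith [inv_lt_of_inv_lt₀ (by positivity) ((le_max_right _ _).trans_lt hlr)]
  have hr0 : 0 < r := zero_lt_one.trans_le hr1
  have hinv : 0 < r⁻¹ - n⁻¹ := sub_pos.2 (inv_strictAnti₀ hr0 hrn)
  refine ⟨⟨r, hr0.le⟩, ⟨(r⁻¹ - n⁻¹)⁻¹, (inv_pos.2 hinv).le⟩, hr1, hrn, (inv_inv _).ge,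
    hrt.imp_left fun h => NNReal.eq h, (lt_inv_comm₀ ht0 hinv).2 hsob⟩

theorem rpow_le_one_add_rpow (t : ℝ≥0∞) {r s : ℝ} (hr : 0 ≤ r) (hrs : r ≤ s) :
    t ^ r ≤ 1 + t ^ s := by
  rcases le_total t 1 with h | h
  · exact (ENNReal.rpow_le_one h hr).trans le_self_add
  · exact (ENNReal.rpow_le_rpow_of_exponent_le h hrs).trans le_add_self

theorem exists_rpow_le_mul_rpow_add {ε : ℝ≥0} (hε : 0 < ε) {κ : ℝ} (hκ : 0 < κ) (q : ℝ) :
    ∃ C : ℝ≥0, ∀ (t : ℝ≥0) (s : ℝ), 1 ≤ s → s ≤ q - κ → t ^ s ≤ ε * t ^ q + C * t := by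
  set B : ℝ≥0 := max 1 (ε ^ (-κ⁻¹))
  have hB : 1 ≤ B := le_max_left _ _
  have hBε : B ^ (-κ) ≤ ε := by
    calc B ^ (-κ) ≤ (ε ^ (-κ⁻¹)) ^ (-κ) :=
          NNReal.rpow_le_rpow_of_nonpos (NNReal.rpow_pos hε) (le_max_right _ _) (by linarith)
      _ = ε := by rw [← NNReal.rpow_mul, neg_mul_neg, inv_mul_cancel₀ hκ.ne', NNReal.rpow_one]
  refine ⟨B ^ q, fun t s hs hsq => ?_⟩
  rcases eq_or_ne t 0 with rfl | h0
  · simp [NNReal.zero_rpow (zero_lt_one.trans_le hs).ne']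
  rcases le_total t B with h | h
  · refine le_trans ?_ le_add_self
    calc t ^ s = t ^ (s - 1) * t := by rw [NNReal.rpow_sub_one h0, div_mul_cancel₀ _ h0]
      _ ≤ B ^ (s - 1) * t := by gcongr
      _ ≤ B ^ q * t := by gcongr; linarith
  · refine le_trans ?_ le_self_add
    calc t ^ s ≤ t ^ (-κ + q) := NNReal.rpow_le_rpow_of_exponent_le (hB.trans h) (by linarith)
      _ = t ^ (-κ) * t ^ q := NNReal.rpow_add h0 _ _
      _ ≤ B ^ (-κ) * t ^ q := by
        gcongr ?_ * _
        exact NNReal.rpow_le_rpow_of_nonpos (zero_lt_one.trans_le hB) h (by linarith)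
      _ ≤ ε * t ^ q := by gcongr

theorem exists_enorm_le_and_enorm_fderiv_le (hψ : ContDiff ℝ 1 ψ) (hψc : HasCompactSupport ψ) :
    ∃ D : ℝ≥0, ∀ x, ‖ψ x‖ₑ ≤ D ∧ ‖fderiv ℝ ψ x‖ₑ ≤ D := by
  obtain ⟨D₁, hD₁⟩ := hψc.exists_bound_of_continuous hψ.continuous
  obtain ⟨D₂, hD₂⟩ := (hψc.fderiv ℝ).exists_bound_of_continuous (hψ.continuous_fderiv one_ne_zero)
  refine ⟨(max D₁ D₂).toNNReal, fun x => ⟨?_, ?_⟩⟩ <;> rw [← ofReal_norm]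
  exacts [ENNReal.ofReal_le_ofReal ((hD₁ x).trans (le_max_left _ _)),
    ENNReal.ofReal_le_ofReal ((hD₂ x).trans (le_max_right _ _))]

theorem enorm_fderiv_mul_rpow_le {x : Euc N} (hψ : DifferentiableAt ℝ ψ x)
    (hφ : DifferentiableAt ℝ φ x) {D : ℝ≥0} (hD : ‖ψ x‖ₑ ≤ D ∧ ‖fderiv ℝ ψ x‖ₑ ≤ D) {r s : ℝ}
    (hr : 1 ≤ r) (hrs : r ≤ s) :
    ‖fderiv ℝ (fun x => ψ x * φ x) x‖ₑ ^ r ≤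
      (D : ℝ≥0∞) ^ r * 2 ^ (r - 1) * (2 + ‖gradient φ x‖ₑ ^ s + ‖φ x‖ₑ ^ s) := by
  have hr0 : 0 ≤ r := zero_le_one.trans hr
  have hleibniz : ‖fderiv ℝ (fun x => ψ x * φ x) x‖ₑ ≤ D * (‖gradient φ x‖ₑ + ‖φ x‖ₑ) := by
    rw [fderiv_fun_mul hψ hφ]
    refine (enorm_add_le (E := Euc N →L[ℝ] ℝ) _ _).trans ?_
    rw [enorm_smul, enorm_smul, mul_add, enorm_gradient, mul_comm ‖φ x‖ₑ]
    gcongr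
    exacts [hD.1, hD.2]
  calc ‖fderiv ℝ (fun x => ψ x * φ x) x‖ₑ ^ r
      ≤ (D * (‖gradient φ x‖ₑ + ‖φ x‖ₑ)) ^ r := by gcongr
    _ = (D : ℝ≥0∞) ^ r * (‖gradient φ x‖ₑ + ‖φ x‖ₑ) ^ r := ENNReal.mul_rpow_of_nonneg _ _ hr0
    _ ≤ (D : ℝ≥0∞) ^ r * (2 ^ (r - 1) * (‖gradient φ x‖ₑ ^ r + ‖φ x‖ₑ ^ r)) := by
      gcongr
      exact ENNReal.rpow_add_le_mul_rpow_add_rpow _ _ hr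
    _ ≤ (D : ℝ≥0∞) ^ r * (2 ^ (r - 1) * (1 + ‖gradient φ x‖ₑ ^ s + (1 + ‖φ x‖ₑ ^ s))) := by
      gcongr <;> exact rpow_le_one_add_rpow _ hr0 hrs
    _ = _ := by rw [add_add_add_comm, one_add_one_eq_two, mul_assoc, add_assoc]

namespace BoundedExponent

theorem lintegral_fderiv_mul_rpow_le (hp : BoundedExponent Ω p b) (hψ : Differentiable ℝ ψ)
    {D : ℝ≥0} (hD : ∀ x, ‖ψ x‖ₑ ≤ D ∧ ‖fderiv ℝ ψ x‖ₑ ≤ D) {r : ℝ} (hr : 1 ≤ r)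
    (hrp : ∀ x ∈ Ω, x ∈ tsupport ψ → r ≤ p x) (hφ : IsTestFunction Ω φ) :
    ∫⁻ x, ‖fderiv ℝ (fun x => ψ x * φ x) x‖ₑ ^ r ≤
      (D : ℝ≥0∞) ^ r * 2 ^ (r - 1) *
        (2 * volume Ω + modular Ω p (gradient φ) + modular Ω p φ) := by
  have hr0 : 0 < r := zero_lt_one.trans_le hr
  have hfderiv : Function.support (fderiv ℝ fun x => ψ x * φ x) ⊆ tsupport ψ ∩ tsupport φ :=
    (support_fderiv_subset ℝ).trans
      (subset_inter tsupport_mul_subset_left tsupport_mul_subset_right)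
  have hsupp : Function.support (fun x => ‖fderiv ℝ (fun x => ψ x * φ x) x‖ₑ ^ r) ⊆
      tsupport ψ ∩ tsupport φ :=
    (Function.support_comp_subset (g := (· ^ r)) (ENNReal.zero_rpow_of_pos hr0) _).trans
      ((Function.support_comp_subset enorm_zero (fderiv ℝ fun x => ψ x * φ x)).trans hfderiv)
  have hmeas : AEMeasurable (fun x => ‖gradient φ x‖ₑ ^ p x) (volume.restrict Ω) :=
    hφ.continuous_gradient.aestronglyMeasurable.enorm.pow hp.aemeasurable
  rw [← setLIntegral_eq_of_support_subset (hsupp.trans (inter_subset_right.trans hφ.2.2))]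
  calc ∫⁻ x in Ω, ‖fderiv ℝ (fun x => ψ x * φ x) x‖ₑ ^ r
      ≤ ∫⁻ x in Ω, (D : ℝ≥0∞) ^ r * 2 ^ (r - 1) *
          (2 + ‖gradient φ x‖ₑ ^ p x + ‖φ x‖ₑ ^ p x) := by
        refine setLIntegral_mono' hp.measurableSet fun x hx => ?_
        by_cases hxψ : x ∈ tsupport ψ
        · exact enorm_fderiv_mul_rpow_le (hψ x) (hφ.differentiable x) (hD x) hr (hrp x hx hxψ)
        · rw [Function.notMem_support.1 fun h => hxψ (hsupp h).1]
          exact bot_le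
    _ = _ := by
        rw [lintegral_const_mul', lintegral_add_left' (hmeas.const_add _),
          lintegral_add_left measurable_const, setLIntegral_const, modular, modular]
        exact ENNReal.mul_ne_top (ENNReal.rpow_ne_top_of_nonneg hr0.le ENNReal.coe_ne_top)
          (ENNReal.rpow_ne_top_of_nonneg (by linarith) ENNReal.ofNat_ne_top)

theorem exists_lintegral_mul_rpow_le (hp : BoundedExponent Ω p b) (hΩ : Bornology.IsBounded Ω)
    (hψ : ContDiff ℝ 1 ψ) (hψc : HasCompactSupport ψ) {r q : ℝ≥0} (hr : 1 ≤ r) (hrN : r < N)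
    (hrq : (r : ℝ)⁻¹ - (N : ℝ)⁻¹ ≤ (q : ℝ)⁻¹) (hq : q ≠ 0)
    (hrp : ∀ x ∈ Ω, x ∈ tsupport ψ → r ≤ p x) (M : ℝ≥0) :
    ∃ A : ℝ≥0, ∀ φ, IsTestFunction Ω φ → modular Ω p φ ≤ M → modular Ω p (gradient φ) ≤ M →
      ∫⁻ x in Ω, ‖ψ x * φ x‖ₑ ^ (q : ℝ) ≤ A := by
  have hr1 : (1 : ℝ) ≤ r := hr
  obtain ⟨D, hD⟩ := exists_enorm_le_and_enorm_fderiv_le hψ hψc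
  set c := eLpNormLESNormFDerivOfLeConst ℝ (volume : Measure (Euc N)) Ω r q
  set A₀ : ℝ≥0∞ := (D : ℝ≥0∞) ^ (r : ℝ) * 2 ^ ((r : ℝ) - 1) * (2 * volume Ω + M + M)
  have hA₀ : A₀ ≠ ⊤ := by
    have hV : volume Ω ≠ ⊤ := hΩ.measure_lt_top.ne
    refine ENNReal.mul_ne_top (ENNReal.mul_ne_top ?_ ?_) (by finiteness)
    · exact ENNReal.rpow_ne_top_of_nonneg r.2 ENNReal.coe_ne_top
    · exact ENNReal.rpow_ne_top_of_nonneg (by linarith) ENNReal.ofNat_ne_top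
  have hA : (c * A₀ ^ (r : ℝ)⁻¹) ^ (q : ℝ) ≠ ⊤ :=
    ENNReal.rpow_ne_top_of_nonneg q.2 (ENNReal.mul_ne_top ENNReal.coe_ne_top
      (ENNReal.rpow_ne_top_of_nonneg (inv_nonneg.2 r.2) hA₀))
  refine ⟨((c * A₀ ^ (r : ℝ)⁻¹) ^ (q : ℝ)).toNNReal, fun φ hφ hM hM' => ?_⟩
  rw [ENNReal.coe_toNNReal hA]
  have hsupp : Function.support (fun x => ψ x * φ x) ⊆ Ω :=
    (Function.support_mul_subset_right _ _).trans ((subset_tsupport φ).trans hφ.2.2)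
  have hsob : eLpNorm (fun x => ψ x * φ x) q volume ≤
      c * eLpNorm (fderiv ℝ fun x => ψ x * φ x) r volume :=
    eLpNorm_le_eLpNorm_fderiv_of_le volume (hψ.mul (hφ.1.of_le (by simp))) hsupp hr
      (by rwa [finrank_euclideanSpace_fin]) (by rwa [finrank_euclideanSpace_fin]) hΩ
  have hgrad : eLpNorm (fderiv ℝ fun x => ψ x * φ x) r volume ≤ A₀ ^ (r : ℝ)⁻¹ := by
    rw [ENNReal.le_rpow_inv_iff (by linarith),
      eLpNorm_nnreal_pow_eq_lintegral (zero_lt_one.trans_le hr).ne']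
    refine (hp.lintegral_fderiv_mul_rpow_le (hψ.differentiable one_ne_zero) hD hr1 hrp hφ).trans ?_
    exact mul_le_mul_right (by gcongr) _
  refine (setLIntegral_le_lintegral _ _).trans ?_
  rw [← eLpNorm_nnreal_pow_eq_lintegral hq]
  gcongr
  exact hsob.trans (by gcongr)

end BoundedExponent

end Sobolev

section Interpolation

variable {Ω : Set (Euc N)} {p : Euc N → ℝ} {b : ℝ}

/-- On the part `s` of `Ω`, the modular of test functions with bounded energy is controlled by the
`L¹` norm up to an arbitrarily small error. -/
def HasModularInterpolation (Ω : Set (Euc N)) (p : Euc N → ℝ) (s : Set (Euc N)) : Prop :=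
  ∀ M ε : ℝ≥0, 0 < ε → ∃ C : ℝ≥0, ∀ φ : Euc N → ℝ, IsTestFunction Ω φ → modular Ω p φ ≤ M →
    modular Ω p (gradient φ) ≤ M →
    ∫⁻ x in Ω ∩ s, ‖φ x‖ₑ ^ p x ≤ ε + C * ∫⁻ x in Ω, ‖φ x‖ₑ

namespace HasModularInterpolation

variable {s t : Set (Euc N)}

theorem empty : HasModularInterpolation Ω p ∅ :=
  fun _ _ _ => ⟨0, fun φ _ _ _ => by simp⟩

theorem mono (ht : HasModularInterpolation Ω p t) (hst : s ⊆ t) :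
    HasModularInterpolation Ω p s := fun M ε hε =>
  (ht M ε hε).imp fun _ hC φ hφ h h' =>
    (lintegral_mono_set (inter_subset_inter_right _ hst)).trans (hC φ hφ h h')

theorem union (hs : HasModularInterpolation Ω p s) (ht : HasModularInterpolation Ω p t) :
    HasModularInterpolation Ω p (s ∪ t) := by
  intro M ε hε
  obtain ⟨C, hC⟩ := hs M (ε / 2) (by positivity)
  obtain ⟨C', hC'⟩ := ht M (ε / 2) (by positivity)
  refine ⟨C + C', fun φ hφ h h' => ?_⟩
  rw [inter_union_distrib_left]
  refine (lintegral_union_le _ _ _).trans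
    ((add_le_add (hC φ hφ h h') (hC' φ hφ h h')).trans_eq ?_)
  rw [add_add_add_comm, ← add_mul, ← ENNReal.coe_add, ← ENNReal.coe_add, add_halves]

end HasModularInterpolation

namespace BoundedExponent

theorem hasModularInterpolation_of_bump (hp : BoundedExponent Ω p b)
    (hΩ : Bornology.IsBounded Ω) {ψ : Euc N → ℝ} (hψ : ContDiff ℝ 1 ψ) (hψc : HasCompactSupport ψ)
    {r q : ℝ≥0} (hr : 1 ≤ r) (hrN : r < N) (hrq : (r : ℝ)⁻¹ - (N : ℝ)⁻¹ ≤ (q : ℝ)⁻¹) (hq : q ≠ 0)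
    {κ : ℝ} (hκ : 0 < κ) (hrp : ∀ x ∈ Ω, x ∈ tsupport ψ → r ≤ p x ∧ p x ≤ q - κ)
    {s : Set (Euc N)} (hs : MeasurableSet s) (hψs : ∀ x ∈ s, ψ x = 1) :
    HasModularInterpolation Ω p s := by
  intro M ε hε
  obtain ⟨A, hA⟩ := hp.exists_lintegral_mul_rpow_le hΩ hψ hψc hr hrN hrq hq
    (fun x hx hxψ => (hrp x hx hxψ).1) M
  obtain ⟨C, hC⟩ := exists_rpow_le_mul_rpow_add (ε := ε / (A + 1)) (by positivity) hκ q
  have hpoint (φ : Euc N → ℝ) : ∀ x ∈ Ω ∩ s,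
      ‖φ x‖ₑ ^ p x ≤ (ε / (A + 1) : ℝ≥0) * ‖ψ x * φ x‖ₑ ^ (q : ℝ) + C * ‖φ x‖ₑ := by
    intro x hx
    have hψx : ψ x = 1 := hψs x hx.2
    have hp1 := hp.one_le x hx.1
    have hpq := (hrp x hx.1 (subset_tsupport ψ (by simp [hψx]))).2
    rw [hψx, one_mul, enorm_eq_nnnorm, ← ENNReal.coe_rpow_of_nonneg _ (zero_le_one.trans hp1),
      ← ENNReal.coe_rpow_of_nonneg _ q.coe_nonneg]
    exact_mod_cast hC ‖φ x‖₊ (p x) hp1 hpq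
  refine ⟨C, fun φ hφ hM hM' => ?_⟩
  calc ∫⁻ x in Ω ∩ s, ‖φ x‖ₑ ^ p x
      ≤ ∫⁻ x in Ω ∩ s, (ε / (A + 1) : ℝ≥0) * ‖ψ x * φ x‖ₑ ^ (q : ℝ) + C * ‖φ x‖ₑ :=
        setLIntegral_mono' (hp.measurableSet.inter hs) (hpoint φ)
    _ ≤ ∫⁻ x in Ω, (ε / (A + 1) : ℝ≥0) * ‖ψ x * φ x‖ₑ ^ (q : ℝ) + C * ‖φ x‖ₑ :=
        lintegral_mono_set inter_subset_left
    _ = (ε / (A + 1) : ℝ≥0) * (∫⁻ x in Ω, ‖ψ x * φ x‖ₑ ^ (q : ℝ)) + C * ∫⁻ x in Ω, ‖φ x‖ₑ := by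
        rw [lintegral_add_right _ (hφ.1.continuous.enorm.measurable.const_mul _),
          lintegral_const_mul' _ _ ENNReal.coe_ne_top, lintegral_const_mul' _ _ ENNReal.coe_ne_top]
    _ ≤ (ε / (A + 1) : ℝ≥0) * A + C * ∫⁻ x in Ω, ‖φ x‖ₑ := by gcongr; exact hA φ hφ hM hM'
    _ ≤ ε + C * ∫⁻ x in Ω, ‖φ x‖ₑ := by
        gcongr
        norm_cast
        rw [div_mul_eq_mul_div, div_le_iff₀ (by positivity)]
        gcongr
        exact le_self_add

theorem exists_mem_nhds_hasModularInterpolation (hp : BoundedExponent Ω p b) (hN : 2 ≤ N)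
    (hΩ : Bornology.IsBounded Ω) {x₀ : Euc N} (hpc : ContinuousWithinAt p Ω x₀) :
    ∃ s ∈ nhds x₀, HasModularInterpolation Ω p s := by
  have hN' : (1 : ℝ) < N := by exact_mod_cast hN
  obtain ⟨r, q, hr, hrN, hrq, hrt, htq⟩ := exists_sobolev_exponents hN' (le_max_left 1 (p x₀))
  obtain ⟨q', htq', hq'⟩ := exists_between htq
  have hq0 : q ≠ 0 := fun h => by
    have := zero_lt_one.trans_le (le_max_left (1 : ℝ) (p x₀))
    simp [h, this.not_gt] at htq
  have hnear : ∀ᶠ x in nhdsWithin x₀ Ω, r ≤ p x ∧ p x ≤ q' := by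
    have hle : ∀ᶠ x in nhdsWithin x₀ Ω, r ≤ p x := by
      rcases hrt with rfl | hrt
      · exact eventually_nhdsWithin_of_forall hp.one_le
      · have hrp : r < p x₀ := (lt_max_iff.1 hrt).resolve_left (not_lt.2 hr)
        exact (hpc.eventually (lt_mem_nhds hrp)).mono fun _ => le_of_lt
    have hge := hpc.eventually (gt_mem_nhds ((le_max_right _ _).trans_lt htq'))
    exact hle.and (hge.mono fun _ => le_of_lt)
  obtain ⟨d, hd, hball⟩ := Metric.mem_nhdsWithin_iff.1 hnear
  let ψ : ContDiffBump x₀ := ⟨d / 4, d / 2, by positivity, by linarith⟩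
  refine ⟨_, Metric.ball_mem_nhds x₀ ψ.rIn_pos, hp.hasModularInterpolation_of_bump hΩ ψ.contDiff
    ψ.hasCompactSupport hr (by exact_mod_cast hrN) hrq hq0 (sub_pos.2 hq') (fun x hx hxψ => ?_)
    Metric.isOpen_ball.measurableSet
    fun x hx => ψ.one_of_mem_closedBall (Metric.ball_subset_closedBall hx)⟩
  rw [ψ.tsupport_eq] at hxψ
  rw [sub_sub_cancel]
  exact hball ⟨Metric.closedBall_subset_ball (half_lt_self hd) hxψ, hx⟩

theorem hasModularInterpolation_closure (hp : BoundedExponent Ω p b) (hN : 2 ≤ N)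
    (hΩ : Bornology.IsBounded Ω) (hpc : ContinuousOn p (closure Ω)) :
    HasModularInterpolation Ω p (closure Ω) := by
  refine hΩ.isCompact_closure.induction_on .empty (fun _ _ hst ht => ht.mono hst)
    (fun _ _ => .union) fun x₀ hx₀ => ?_
  obtain ⟨s, hs, hI⟩ := hp.exists_mem_nhds_hasModularInterpolation hN hΩ
    ((hpc x₀ hx₀).mono subset_closure)
  exact ⟨s, mem_nhdsWithin_of_mem_nhds hs, hI⟩

end BoundedExponent

end Interpolation

section LuxemburgInterpolation

variable {Ω : Set (Euc N)} {p : Euc N → ℝ} {b : ℝ}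

namespace BoundedExponent

theorem modular_lt_top_of_bound {F : Type*} [NormedAddCommGroup F] (hp : BoundedExponent Ω p b)
    (hΩ : volume Ω ≠ ⊤) {f : Euc N → F} {D : ℝ≥0} (hD : ∀ x ∈ Ω, ‖f x‖ₑ ≤ D) :
    modular Ω p f < ⊤ := by
  set D' : ℝ≥0 := max 1 D
  have hD1 : (1 : ℝ≥0∞) ≤ D' := by exact_mod_cast le_max_left 1 D
  have hD'b : (D' : ℝ≥0∞) ^ b < ⊤ :=
    (ENNReal.rpow_ne_top_of_ne_zero (zero_lt_one.trans_le hD1).ne' ENNReal.coe_ne_top).lt_top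
  calc modular Ω p f ≤ ∫⁻ _ in Ω, (D' : ℝ≥0∞) ^ b := by
        refine setLIntegral_mono' hp.measurableSet fun x hx => ?_
        have hfD : ‖f x‖ₑ ≤ D' := (hD x hx).trans (by exact_mod_cast le_max_right 1 D)
        exact (ENNReal.rpow_le_rpow hfD (zero_le_one.trans (hp.one_le x hx))).trans
          (ENNReal.rpow_le_rpow_of_exponent_le hD1 (hp.le x hx))
    _ = (D' : ℝ≥0∞) ^ b * volume Ω := setLIntegral_const _ _
    _ < ⊤ := ENNReal.mul_lt_top hD'b hΩ.lt_top

theorem luxNorm_lt_top_of_isTestFunction (hp : BoundedExponent Ω p b) (hΩ : volume Ω ≠ ⊤)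
    {φ : Euc N → ℝ} (hφ : IsTestFunction Ω φ) : luxNorm Ω p φ < ⊤ := by
  obtain ⟨D, hD⟩ := exists_enorm_le_and_enorm_fderiv_le (hφ.1.of_le (by simp)) hφ.2.1
  exact hp.luxNorm_lt_top_iff.2 (hp.modular_lt_top_of_bound hΩ fun x _ => (hD x).1)

theorem exists_one_le_mul_lintegral_of_luxNorm_eq_two (hp : BoundedExponent Ω p b)
    (hI : HasModularInterpolation Ω p Ω) (B : ℝ≥0) :
    ∃ C : ℝ≥0, ∀ φ, IsTestFunction Ω φ → luxNorm Ω p φ = 2 → luxNorm Ω p (gradient φ) < B →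
      1 ≤ C * ∫⁻ x in Ω, ‖φ x‖ₑ := by
  set B' : ℝ≥0 := max 3 B
  have hB' : 1 ≤ B' := le_max_of_le_left (by norm_num)
  have h2B : (2 : ℝ≥0∞) < B' := by
    exact_mod_cast (lt_max_of_lt_left (by norm_num) : (2 : ℝ≥0) < B')
  have hB'b : (B' : ℝ≥0∞) ^ b ≠ ⊤ :=
    ENNReal.rpow_ne_top_of_ne_zero (by exact_mod_cast (zero_lt_one.trans_le hB').ne')
      ENNReal.coe_ne_top
  obtain ⟨C, hC⟩ := hI ((B' : ℝ≥0∞) ^ b).toNNReal 2⁻¹ (by positivity)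
  rw [ENNReal.coe_toNNReal hB'b, inter_self] at hC
  refine ⟨2 * C, fun φ hφ hlux hgrad => ?_⟩
  have hone : 1 ≤ modular Ω p φ := by
    by_contra! h
    have hle := luxNorm_le (Ω := Ω) (p := p) (f := φ) one_pos (by simpa using h.le)
    norm_num [hlux] at hle
  have hmod := hC φ hφ (hp.modular_le_of_luxNorm_lt hB' (hlux.trans_lt h2B))
    (hp.modular_le_of_luxNorm_lt hB' (hgrad.trans_le (by exact_mod_cast le_max_right 3 B)))
  have hhalf : (1 : ℝ≥0∞) ≤ 2⁻¹ + C * ∫⁻ x in Ω, ‖φ x‖ₑ := by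
    simpa using hone.trans hmod
  rw [← ENNReal.inv_two_add_inv_two] at hhalf
  have hle := (ENNReal.add_le_add_iff_left (by simp)).1 hhalf
  calc (1 : ℝ≥0∞) = 2 * 2⁻¹ := (ENNReal.mul_inv_cancel two_ne_zero ENNReal.ofNat_ne_top).symm
    _ ≤ 2 * (C * ∫⁻ x in Ω, ‖φ x‖ₑ) := by gcongr
    _ = _ := by rw [ENNReal.coe_mul, mul_assoc, ENNReal.coe_ofNat]

theorem exists_luxNorm_le_of_isTestFunction (hp : BoundedExponent Ω p b) (hΩ : volume Ω ≠ ⊤)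
    (hI : HasModularInterpolation Ω p Ω) {η : ℝ≥0} (hη : 0 < η) :
    ∃ C : ℝ≥0, ∀ φ, IsTestFunction Ω φ →
      luxNorm Ω p φ ≤ η * luxNorm Ω p (gradient φ) + C * ∫⁻ x in Ω, ‖φ x‖ₑ := by
  obtain ⟨C, hC⟩ := hp.exists_one_le_mul_lintegral_of_luxNorm_eq_two hI (2 / η)
  have htwo (φ : Euc N → ℝ) (hφ : IsTestFunction Ω φ) (hlux : luxNorm Ω p φ = 2) :
      2 ≤ η * luxNorm Ω p (gradient φ) + (2 * C : ℝ≥0) * ∫⁻ x in Ω, ‖φ x‖ₑ := by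
    rcases lt_or_ge (luxNorm Ω p (gradient φ)) (2 / η : ℝ≥0) with hlt | hge
    · refine le_add_left ?_
      rw [ENNReal.coe_mul, mul_assoc, ENNReal.coe_ofNat]
      exact le_mul_of_one_le_right' (hC φ hφ hlux hlt)
    · refine le_add_right (le_trans ?_ (mul_le_mul_right hge _))
      rw [← ENNReal.coe_mul, mul_div_cancel₀ _ hη.ne', ENNReal.coe_ofNat]
  refine ⟨2 * C, fun φ hφ => ?_⟩
  have hfin := hp.luxNorm_lt_top_of_isTestFunction hΩ hφ
  rcases eq_or_ne (luxNorm Ω p φ) 0 with h0 | h0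
  · exact h0.trans_le bot_le
  obtain ⟨c, hc⟩ : ∃ c : ℝ, ‖c‖ₑ = 2 / luxNorm Ω p φ := by
    refine ⟨(2 / luxNorm Ω p φ).toReal, ?_⟩
    rw [Real.enorm_of_nonneg ENNReal.toReal_nonneg, ENNReal.ofReal_toReal]
    exact ENNReal.div_ne_top ENNReal.ofNat_ne_top h0
  have hscale : ‖c‖ₑ * luxNorm Ω p φ = 2 := by rw [hc, ENNReal.div_mul_cancel h0 hfin.ne]
  have hgrad : gradient (fun x => c • φ x) = fun x => c • gradient φ x :=
    funext fun x => gradient_fun_const_smul (hφ.differentiable x) c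
  have hle := htwo _ (hφ.const_smul c) ((hp.luxNorm_smul c).trans hscale)
  simp only [hgrad, hp.luxNorm_smul, enorm_smul] at hle
  rw [lintegral_const_mul' _ _ enorm_ne_top, mul_left_comm, mul_left_comm _ ‖c‖ₑ,
    ← mul_add] at hle
  exact (ENNReal.mul_le_mul_iff_right (fun h => by simp [h] at hscale) enorm_ne_top).1
    (hscale.trans_le hle)

theorem exists_luxNorm_le_gradient_add_lintegral (hp : BoundedExponent Ω p b) (hN : 2 ≤ N)
    (hΩ : Bornology.IsBounded Ω) (hpc : ContinuousOn p (closure Ω)) {η : ℝ≥0} (hη : 0 < η) :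
    ∃ C : ℝ≥0, ∀ u G, HasW0Grad Ω p u G →
      luxNorm Ω p u ≤ η * luxNorm Ω p G + C * ∫⁻ x in Ω, ‖u x‖ₑ := by
  have hV : volume Ω ≠ ⊤ := hΩ.measure_lt_top.ne
  obtain ⟨C, hC⟩ := hp.exists_luxNorm_le_of_isTestFunction hV
    ((hp.hasModularInterpolation_closure hN hΩ hpc).mono subset_closure) hη
  refine ⟨C, fun u G h => le_of_forall_pos_le_add_mul (η + C + 1) fun κ hκ => ?_⟩
  obtain ⟨φ, hφ, hlux, hgrad, -, hint⟩ := h.exists_isTestFunction_approx hp hV hκ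
  calc luxNorm Ω p u
      ≤ η * luxNorm Ω p (gradient φ) + C * (∫⁻ x in Ω, ‖φ x‖ₑ) + κ :=
        hlux.trans (add_le_add_left (hC φ hφ) _)
    _ ≤ η * (luxNorm Ω p G + κ) + C * ((∫⁻ x in Ω, ‖u x‖ₑ) + κ) + κ := by gcongr
    _ = _ := by push_cast; ring

end BoundedExponent

end LuxemburgInterpolation

section OddSchauderProjection

variable {V : Type*} [NormedAddCommGroup V]

/-- The tent function of radius `δ` centred at `w`. -/
def tent (δ : ℝ) (w u : V) : ℝ :=
  max 0 (δ - ‖u - w‖)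

/-- The total weight that the tents around the points of `t ∪ -t` give to `u`, points of `t ∩ -t`
being counted twice. -/
def oddMass (δ : ℝ) (t : Finset V) (u : V) : ℝ :=
  ∑ w ∈ t, (tent δ w u + tent δ w (-u))

/-- The coefficient of `w` in the odd Schauder projection: the partition of unity subordinate to the
`δ`-balls around `t ∪ -t` attaches `tent δ w u` to `w` and `tent δ w (-u)` to `-w`, up to the factor
`oddMass δ t u`. -/
noncomputable def oddCoeff (δ : ℝ) (t : Finset V) (w u : V) : ℝ :=
  (tent δ w u - tent δ w (-u)) / oddMass δ t u

variable {δ : ℝ} {t : Finset V}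

theorem tent_nonneg (w u : V) : 0 ≤ tent δ w u :=
  le_max_left _ _

theorem tent_pos {w u : V} (h : dist u w < δ) : 0 < tent δ w u :=
  lt_max_of_lt_right (sub_pos.2 (dist_eq_norm u w ▸ h))

theorem continuous_tent (w : V) : Continuous (tent δ w) := by
  unfold tent
  fun_prop

theorem tent_mul_norm_sub_le (w u : V) : tent δ w u * ‖u - w‖ ≤ tent δ w u * δ := by
  rcases le_total ‖u - w‖ δ with h | h
  · exact mul_le_mul_of_nonneg_left h (tent_nonneg w u)
  · simp [tent, max_eq_left (sub_nonpos.2 h)]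

theorem oddMass_neg (u : V) : oddMass δ t (-u) = oddMass δ t u := by
  simp only [oddMass, neg_neg, add_comm]

theorem oddMass_pos {u : V} (h : ∃ w ∈ t, dist u w < δ) : 0 < oddMass δ t u := by
  obtain ⟨w, hw, huw⟩ := h
  exact Finset.sum_pos' (fun w _ => add_nonneg (tent_nonneg w u) (tent_nonneg w (-u)))
    ⟨w, hw, add_pos_of_pos_of_nonneg (tent_pos huw) (tent_nonneg w (-u))⟩

theorem oddCoeff_neg (w u : V) : oddCoeff δ t w (-u) = -oddCoeff δ t w u := by
  simp only [oddCoeff, oddMass_neg, neg_neg, ← neg_div, neg_sub]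

theorem continuousOn_oddCoeff {K : Set V} (hK : ∀ u ∈ K, 0 < oddMass δ t u) (w : V) :
    ContinuousOn (oddCoeff δ t w) K := by
  have htent (w : V) : Continuous fun u : V => tent δ w (-u) :=
    (continuous_tent w).comp continuous_neg
  refine ((continuous_tent w).sub (htent w)).continuousOn.div ?_ fun u hu => (hK u hu).ne'
  exact (continuous_finsetSum t fun w _ => (continuous_tent w).add (htent w)).continuousOn

theorem sum_abs_oddCoeff_le {u : V} (hu : 0 < oddMass δ t u) : ∑ w ∈ t, |oddCoeff δ t w u| ≤ 1 := by
  calc ∑ w ∈ t, |oddCoeff δ t w u|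
      ≤ ∑ w ∈ t, (tent δ w u + tent δ w (-u)) / oddMass δ t u := by
        refine Finset.sum_le_sum fun w _ => ?_
        rw [oddCoeff, abs_div, abs_of_pos hu]
        gcongr
        simpa only [abs_of_nonneg, tent_nonneg] using abs_sub (tent δ w u) (tent δ w (-u))
    _ = 1 := by rw [← Finset.sum_div, ← oddMass, div_self hu.ne']

theorem exists_finset_oddMass_pos {K : Set V} (hK : IsCompact K) (hδ : 0 < δ) :
    ∃ t : Finset V, ↑t ⊆ K ∧ ∀ u ∈ K, 0 < oddMass δ t u := by
  obtain ⟨t', ht'K, ht'f, hcov⟩ := hK.finite_cover_balls hδ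
  obtain ⟨t, rfl⟩ := ht'f.exists_finset_coe
  refine ⟨t, ht'K, fun u hu => oddMass_pos ?_⟩
  simpa using hcov hu

variable [NormedSpace ℝ V]

theorem oddMass_smul_sub_sum_oddCoeff_smul {u : V} (hu : oddMass δ t u ≠ 0) :
    oddMass δ t u • (u - ∑ w ∈ t, oddCoeff δ t w u • w) =
      ∑ w ∈ t, (tent δ w u • (u - w) - tent δ w (-u) • (-u - w)) := by
  rw [smul_sub, Finset.smul_sum]
  nth_rw 1 [oddMass]
  rw [Finset.sum_smul, ← Finset.sum_sub_distrib]
  refine Finset.sum_congr rfl fun w _ => ?_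
  rw [smul_smul, oddCoeff, mul_div_cancel₀ _ hu]
  module

theorem norm_sub_sum_oddCoeff_smul_le {u : V} (hu : 0 < oddMass δ t u) :
    ‖u - ∑ w ∈ t, oddCoeff δ t w u • w‖ ≤ δ := by
  refine le_of_mul_le_mul_left ?_ hu
  calc oddMass δ t u * ‖u - ∑ w ∈ t, oddCoeff δ t w u • w‖
      = ‖∑ w ∈ t, (tent δ w u • (u - w) - tent δ w (-u) • (-u - w))‖ := by
        rw [← oddMass_smul_sub_sum_oddCoeff_smul hu.ne', norm_smul, Real.norm_of_nonneg hu.le]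
    _ ≤ ∑ w ∈ t, (tent δ w u + tent δ w (-u)) * δ := by
        refine norm_sum_le_of_le t fun w _ => (norm_sub_le _ _).trans ?_
        rw [norm_smul, norm_smul, Real.norm_of_nonneg (tent_nonneg w u),
          Real.norm_of_nonneg (tent_nonneg w (-u)), add_mul]
        exact add_le_add (tent_mul_norm_sub_le w u) (tent_mul_norm_sub_le w (-u))
    _ = oddMass δ t u * δ := by rw [← Finset.sum_mul, oddMass]

variable {E ν : V → ℝ≥0∞} {K : Set V} {c : ℝ≥0}

theorem IsExtSeminorm.sum_oddCoeff_smul_le (hE : IsExtSeminorm E) (ht : ∀ w ∈ t, E w ≤ c) {u : V}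
    (hu : 0 < oddMass δ t u) : E (∑ w ∈ t, oddCoeff δ t w u • w) ≤ c := by
  calc E (∑ w ∈ t, oddCoeff δ t w u • w)
      ≤ ∑ w ∈ t, ‖oddCoeff δ t w u‖ₑ * E w := hE.sum_smul_le t _ _
    _ ≤ ∑ w ∈ t, ‖oddCoeff δ t w u‖ₑ * c :=
        Finset.sum_le_sum fun w hw => mul_le_mul_right (ht w hw) _
    _ = ENNReal.ofReal (∑ w ∈ t, |oddCoeff δ t w u|) * c := by
        rw [← Finset.sum_mul, ENNReal.ofReal_sum_of_nonneg fun _ _ => abs_nonneg _]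
        simp only [Real.enorm_eq_ofReal_abs]
    _ ≤ c := mul_le_of_le_one_left bot_le (by simpa using sum_abs_oddCoeff_le hu)

theorem exists_oddCoeff_approx (hE : IsExtSeminorm E) (hν : IsExtSeminorm ν)
    (hI : ∀ η : ℝ≥0, 0 < η → ∃ C : ℝ≥0, ∀ u, ν u ≤ η * E u + C * ‖u‖ₑ) (hK : IsCompact K)
    (hc : ∀ u ∈ K, E u ≤ c) {τ : ℝ≥0} (hτ : 0 < τ) :
    ∃ (t : Finset V) (δ : ℝ), ↑t ⊆ K ∧ ∀ u ∈ K, 0 < oddMass δ t u ∧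
      E (∑ w ∈ t, oddCoeff δ t w u • w) ≤ c ∧ ν u ≤ ν (∑ w ∈ t, oddCoeff δ t w u • w) + τ := by
  have hdiv (x : ℝ≥0) : τ / 2 / (x + 1) * x ≤ τ / 2 :=
    (mul_le_mul_right le_self_add _).trans_eq (div_mul_cancel₀ _ (by positivity))
  obtain ⟨C, hC⟩ := hI (τ / 2 / (c + c + 1)) (by positivity)
  obtain ⟨t, htK, ht⟩ := exists_finset_oddMass_pos hK (δ := (τ / 2 / (C + 1) : ℝ≥0))
    (by positivity)
  refine ⟨t, (τ / 2 / (C + 1) : ℝ≥0), htK, fun u hu => ?_⟩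
  have hPu := hE.sum_oddCoeff_smul_le (fun w hw => hc w (htK hw)) (ht u hu)
  refine ⟨ht u hu, hPu, (hν.le_add_sub u _).trans (add_le_add_right ?_ _)⟩
  have hdist : ‖u - ∑ w ∈ t, oddCoeff ((τ / 2 / (C + 1) : ℝ≥0) : ℝ) t w u • w‖ₑ ≤
      (τ / 2 / (C + 1) : ℝ≥0) := by
    rw [← ofReal_norm, ← ENNReal.ofReal_coe_nnreal]
    exact ENNReal.ofReal_le_ofReal (norm_sub_sum_oddCoeff_smul_le (ht u hu))
  calc _ ≤ (τ / 2 / (c + c + 1) : ℝ≥0) * ((c : ℝ≥0∞) + c) + C * (τ / 2 / (C + 1) : ℝ≥0) :=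
        (hC _).trans (add_le_add (mul_le_mul_right ((hE.sub_le _ _).trans
          (add_le_add (hc u hu) hPu)) _) (mul_le_mul_right hdist _))
    _ ≤ τ := by
        rw [mul_comm (C : ℝ≥0∞)]
        exact_mod_cast (add_le_add (hdiv (c + c)) (hdiv C)).trans_eq (add_halves τ)

theorem IsExtSeminorm.exists_normalized_combination (hE : IsExtSeminorm E)
    (hν : IsExtSeminorm ν) {X : Type*} [TopologicalSpace X] [Neg X] {K : Set X} {β : V → X → ℝ}
    (hβc : ∀ w, ContinuousOn (β w) K) (hβneg : ∀ w x, β w (-x) = -β w x) {r : ℝ≥0} (hr : 0 < r)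
    (ht : ∀ w ∈ t, ν w ≠ ⊤) (hlow : ∀ x ∈ K, r ≤ ν (∑ w ∈ t, β w x • w)) :
    ∃ β' : V → X → ℝ, (∀ w, ContinuousOn (β' w) K) ∧ (∀ w x, β' w (-x) = -β' w x) ∧
      ∀ x ∈ K, ν (∑ w ∈ t, β' w x • w) = 1 ∧
        E (∑ w ∈ t, β' w x • w) ≤ (r : ℝ≥0∞)⁻¹ * E (∑ w ∈ t, β w x • w) := by
  set P : X → V := fun x => ∑ w ∈ t, β w x • w with hP
  have hne (x : X) (hx : x ∈ K) : ν (P x) ≠ 0 :=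
    ((ENNReal.coe_pos.2 hr).trans_le (hlow x hx)).ne'
  have hfin (x : X) : ν (P x) ≠ ⊤ :=
    ((hν.sum_smul_le t _ _).trans_lt (ENNReal.sum_lt_top.2 fun w hw =>
      ENNReal.mul_lt_top enorm_lt_top (ht w hw).lt_top)).ne
  have hpos (x : X) (hx : x ∈ K) : 0 < (ν (P x)).toReal := ENNReal.toReal_pos (hne x hx) (hfin x)
  have hnorm (x : X) (hx : x ∈ K) : ‖(ν (P x)).toReal⁻¹‖ₑ = (ν (P x))⁻¹ := by
    rw [enorm_inv (hpos x hx).ne', Real.enorm_of_nonneg ENNReal.toReal_nonneg,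
      ENNReal.ofReal_toReal (hfin x)]
  have hPneg (x : X) : P (-x) = -P x := by
    simp only [hP, hβneg, neg_smul, Finset.sum_neg_distrib]
  have hνc : ContinuousOn (fun x => (ν (P x)).toReal) K :=
    ENNReal.continuousOn_toReal.comp (hν.continuousOn_sum_smul ht hβc) fun x _ => hfin x
  refine ⟨fun w x => (ν (P x)).toReal⁻¹ * β w x,
    fun w => (hνc.inv₀ fun x hx => (hpos x hx).ne').mul (hβc w), fun w x => ?_, fun x hx => ?_⟩
  · simp only [hPneg, hν.neg, hβneg, mul_neg]
  · have hsmul : ∑ w ∈ t, ((ν (P x)).toReal⁻¹ * β w x) • w = (ν (P x)).toReal⁻¹ • P x := by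
      simp only [hP, Finset.smul_sum, smul_smul]
    simp only [hsmul, hν.smul, hE.smul, hnorm x hx]
    exact ⟨ENNReal.inv_mul_cancel (hne x hx) (hfin x),
      mul_le_mul_left (ENNReal.inv_le_inv.2 (hlow x hx)) _⟩

theorem exists_odd_normalized_combination (hE : IsExtSeminorm E) (hν : IsExtSeminorm ν)
    (hI : ∀ η : ℝ≥0, 0 < η → ∃ C : ℝ≥0, ∀ u, ν u ≤ η * E u + C * ‖u‖ₑ) (hK : IsCompact K)
    (hc : ∀ u ∈ K, E u ≤ c) (hνK : ∀ u ∈ K, ν u = 1) {κ : ℝ≥0} (hκ : 0 < κ) :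
    ∃ (t : Finset V) (β : V → V → ℝ), ↑t ⊆ K ∧ (∀ w, ContinuousOn (β w) K) ∧
      (∀ w u, β w (-u) = -β w u) ∧
      ∀ u ∈ K, ν (∑ w ∈ t, β w u • w) = 1 ∧ E (∑ w ∈ t, β w u • w) ≤ c + c * κ := by
  obtain ⟨t, δ, htK, ht⟩ := exists_oddCoeff_approx hE hν hI hK hc (τ := κ / (1 + κ))
    (by positivity)
  have hlow (u : V) (hu : u ∈ K) :
      ((1 + κ)⁻¹ : ℝ≥0) ≤ ν (∑ w ∈ t, oddCoeff δ t w u • w) := by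
    have hsum : (((1 + κ)⁻¹ : ℝ≥0) : ℝ≥0∞) + (κ / (1 + κ) : ℝ≥0) = 1 := by
      rw [← ENNReal.coe_add, inv_eq_one_div, ← add_div, div_self (by positivity), ENNReal.coe_one]
    have hone := (hνK u hu).symm.trans_le (ht u hu).2.2
    exact (ENNReal.add_le_add_iff_right ENNReal.coe_ne_top).1 (hsum.trans_le hone)
  obtain ⟨β, hβc, hβneg, hβ⟩ := hE.exists_normalized_combination hν
    (continuousOn_oddCoeff fun u hu => (ht u hu).1) oddCoeff_neg (r := (1 + κ)⁻¹) (by positivity)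
    (fun w hw => by simp [hνK w (htK hw)]) hlow
  refine ⟨t, β, htK, hβc, hβneg, fun u hu => ⟨(hβ u hu).1, (hβ u hu).2.trans ?_⟩⟩
  calc (((1 + κ)⁻¹ : ℝ≥0) : ℝ≥0∞)⁻¹ * E (∑ w ∈ t, oddCoeff δ t w u • w)
      ≤ (1 + κ) * c := by
        rw [ENNReal.coe_inv (by positivity), inv_inv, ENNReal.coe_add, ENNReal.coe_one]
        exact mul_le_mul_right (ht u hu).2.1 _
    _ = c + c * κ := by ring

end OddSchauderProjection

section Minimax

theorem genus_le_of_odd_map {X Y : Type*} [TopologicalSpace X] [Neg X] [TopologicalSpace Y] [Neg Y]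
    {A : Set X} {B : Set Y} {h : X → Y} (hc : ContinuousOn h A) (hAB : MapsTo h A B)
    (hodd : ∀ x ∈ A, h (-x) = -h x) : genus A ≤ genus B := by
  refine le_iInf₂ fun k ⟨f, hf, hfodd, hne⟩ => iInf₂_le k ⟨f ∘ h, hf.comp hc hAB, fun x hx => ?_,
    fun x hx => hne _ (hAB hx)⟩
  simp only [Function.comp_apply, hodd x hx, hfodd _ (hAB hx)]

theorem image_mem_symmFamily {X Y : Type*} [TopologicalSpace X] [InvolutiveNeg X]
    [TopologicalSpace Y] [InvolutiveNeg Y] {S : Set X} {T : Set Y} {m : ℕ} {K : Set X} {h : X → Y}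
    (hK : K ∈ symmFamily S m) (hc : ContinuousOn h K) (hKT : MapsTo h K T)
    (hodd : ∀ x ∈ K, h (-x) = -h x) : h '' K ∈ symmFamily T m := by
  obtain ⟨-, hcompact, hsymm, hgenus⟩ := hK
  have himage : -(h '' K) = h '' K := by
    calc -(h '' K) = (fun x => h (-x)) '' K := by
          rw [← image_neg_eq_neg, image_image]
          exact image_congr fun x hx => (hodd x hx).symm
      _ = h '' K := by rw [← image_image h, image_neg_eq_neg, ← hsymm]
  exact ⟨hKT.image_subset, hcompact.image_of_continuousOn hc, himage.symm,
    hgenus.trans (genus_le_of_odd_map hc (mapsTo_image h K) hodd)⟩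

variable {Ω : Set (Euc N)} {p : Euc N → ℝ} {b : ℝ}

noncomputable instance W0.instInvolutiveNeg (Ω : Set (Euc N)) (p : Euc N → ℝ) :
    InvolutiveNeg (W0 Ω p) where
  neg_neg u := Subtype.ext (neg_neg u.1)

theorem W0.tendsto_of_gradNorm {X : Type*} {l : Filter X} {f : X → W0 Ω p} {u : W0 Ω p}
    (h : Filter.Tendsto (fun x => gradNorm Ω p ((f x).1 - u.1)) l (nhds 0)) :
    Filter.Tendsto f l (nhds u) := by
  refine tendsto_nhds.2 fun U hU hu => ?_
  obtain ⟨ε, hε, hball⟩ := hU u hu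
  exact (h.eventually_lt_const hε).mono fun x => hball (f x)

theorem enorm_L1_eq_lintegral (u : L1 Ω) : ‖u‖ₑ = ∫⁻ x in Ω, ‖u x‖ₑ := by
  rw [Lp.enorm_def, eLpNorm_one_eq_lintegral_enorm]

namespace BoundedExponent

theorem memW0_sub (hp : BoundedExponent Ω p b) (hΩ : IsOpen Ω) {u v : L1 Ω} (hu : MemW0 Ω p u)
    (hv : MemW0 Ω p v) : MemW0 Ω p (u - v : L1 Ω) := by
  rw [hp.memW0_iff_energy_ne_top hΩ] at hu hv ⊢
  exact (((hp.isExtSeminorm_energy hΩ).sub_le u v).trans_lt (ENNReal.add_lt_top.2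
    ⟨hu.lt_top, hv.lt_top⟩)).ne

theorem memW0_sum_smul (hp : BoundedExponent Ω p b) (hΩ : IsOpen Ω) {t : Finset (L1 Ω)}
    (ht : ∀ w ∈ t, energy Ω p w ≠ ⊤) (c : L1 Ω → ℝ) : MemW0 Ω p (∑ w ∈ t, c w • w : L1 Ω) := by
  rw [hp.memW0_iff_energy_ne_top hΩ]
  exact (((hp.isExtSeminorm_energy hΩ).sum_smul_le t c id).trans_lt (ENNReal.sum_lt_top.2
    fun w hw => ENNReal.mul_lt_top enorm_lt_top (ht w hw).lt_top)).ne

theorem exists_enorm_le_gradNorm (hp : BoundedExponent Ω p b) (hN : 2 ≤ N) (hΩ : IsOpen Ω)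
    (hΩb : Bornology.IsBounded Ω) :
    ∃ C : ℝ≥0, ∀ u : L1 Ω, MemW0 Ω p u → ‖u‖ₑ ≤ C * gradNorm Ω p u := by
  obtain ⟨C, hC⟩ := hp.exists_lintegral_le_luxNorm_gradient hN hΩb
  refine ⟨C, fun u hu => ?_⟩
  obtain ⟨G, hG⟩ := memW0_iff_exists_hasW0Grad.1 hu
  rw [hG.gradNorm_eq hΩ, enorm_L1_eq_lintegral]
  exact hC u G hG

theorem continuous_W0_val (hp : BoundedExponent Ω p b) (hN : 2 ≤ N) (hΩ : IsOpen Ω)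
    (hΩb : Bornology.IsBounded Ω) : Continuous fun u : W0 Ω p => u.1 := by
  obtain ⟨C, hC⟩ := hp.exists_enorm_le_gradNorm hN hΩ hΩb
  refine continuous_def.2 fun U hU u hu => ?_
  obtain ⟨ε, hε, hball⟩ := EMetric.isOpen_iff.1 hU u.1 hu
  refine ⟨ε / (C + 1), ENNReal.div_pos hε.ne' (by simp), fun v hv => hball ?_⟩
  rw [Metric.mem_eball, edist_eq_enorm_sub]
  calc ‖v.1 - u.1‖ₑ ≤ C * gradNorm Ω p (v.1 - u.1) := hC _ (hp.memW0_sub hΩ v.2 u.2)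
    _ ≤ (C + 1) * gradNorm Ω p (v.1 - u.1) := mul_le_mul_left le_self_add _
    _ < ε := ENNReal.mul_lt_of_lt_div' hv

theorem iInf_familyL1_le (hp : BoundedExponent Ω p b) (hN : 2 ≤ N) (hΩ : IsOpen Ω)
    (hΩb : Bornology.IsBounded Ω) (m : ℕ) :
    ⨅ K ∈ familyL1 Ω p m, ⨆ u ∈ K, energy Ω p u ≤
      ⨅ K ∈ familyW0 Ω p m, ⨆ u ∈ K, energy Ω p u.1 := by
  refine le_iInf₂ fun K hK => iInf₂_le_of_le ((fun u : W0 Ω p => u.1) '' K) ?_ iSup_image.le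
  exact image_mem_symmFamily hK (hp.continuous_W0_val hN hΩ hΩb).continuousOn hK.1 fun _ _ => rfl

theorem exists_luxNorm_le_energy_add_enorm (hp : BoundedExponent Ω p b) (hN : 2 ≤ N)
    (hΩ : IsOpen Ω) (hΩb : Bornology.IsBounded Ω) (hpc : ContinuousOn p (closure Ω)) {η : ℝ≥0}
    (hη : 0 < η) :
    ∃ C : ℝ≥0, ∀ u : L1 Ω, luxNorm Ω p u ≤ η * energy Ω p u + C * ‖u‖ₑ := by
  obtain ⟨C, hC⟩ := hp.exists_luxNorm_le_gradient_add_lintegral hN hΩb hpc hη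
  refine ⟨C, fun u => ?_⟩
  by_cases hu : MemW0 Ω p u
  · obtain ⟨G, hG⟩ := memW0_iff_exists_hasW0Grad.1 hu
    rw [hG.energy_eq hΩ, enorm_L1_eq_lintegral]
    exact hC u G hG
  · rw [energy_eq_top hu, ENNReal.mul_top (ENNReal.coe_ne_zero.2 hη.ne'), top_add]
    exact le_top

theorem exists_mem_familyW0 (hp : BoundedExponent Ω p b) (hN : 2 ≤ N) (hΩ : IsOpen Ω)
    (hΩb : Bornology.IsBounded Ω) (hpc : ContinuousOn p (closure Ω)) {m : ℕ} {K : Set (L1 Ω)}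
    (hK : K ∈ familyL1 Ω p m) {c : ℝ≥0} (hc : ∀ u ∈ K, energy Ω p u ≤ c) {κ : ℝ≥0} (hκ : 0 < κ) :
    ∃ K' ∈ familyW0 Ω p m, ∀ u ∈ K', energy Ω p u.1 ≤ c + c * κ := by
  have hE := hp.isExtSeminorm_energy hΩ
  obtain ⟨t, β, htK, hβc, hβneg, hβ⟩ := exists_odd_normalized_combination hE
    hp.isExtSeminorm_luxNorm (fun η => hp.exists_luxNorm_le_energy_add_enorm hN hΩ hΩb hpc)
    hK.2.1 hc (fun u hu => hp.gFun_eq_one_iff.1 (hK.1 hu)) hκ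
  have ht (w : L1 Ω) (hw : w ∈ t) : energy Ω p w ≠ ⊤ :=
    ((hc w (htK hw)).trans_lt ENNReal.coe_lt_top).ne
  set Q : L1 Ω → W0 Ω p := fun u =>
    ⟨∑ w ∈ t, β w u • w, hp.memW0_sum_smul hΩ ht fun w => β w u⟩
  have hQc : ContinuousOn Q K := fun u hu => W0.tendsto_of_gradNorm <|
    (hE.tendsto_sum_smul_sub ht hβc hu).congr fun v =>
      energy_eq_gradNorm (hp.memW0_sub hΩ (Q v).2 (Q u).2)
  refine ⟨Q '' K, image_mem_symmFamily hK hQc (fun u hu => hp.gFun_eq_one_iff.2 (hβ u hu).1)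
    fun u _ => Subtype.ext ?_, forall_mem_image.2 fun u hu => (hβ u hu).2⟩
  change ∑ w ∈ t, β w (-u) • w = -∑ w ∈ t, β w u • w
  simp only [hβneg, neg_smul, Finset.sum_neg_distrib]

theorem iInf_familyW0_le (hp : BoundedExponent Ω p b) (hN : 2 ≤ N) (hΩ : IsOpen Ω)
    (hΩb : Bornology.IsBounded Ω) (hpc : ContinuousOn p (closure Ω)) (m : ℕ) :
    ⨅ K ∈ familyW0 Ω p m, ⨆ u ∈ K, energy Ω p u.1 ≤
      ⨅ K ∈ familyL1 Ω p m, ⨆ u ∈ K, energy Ω p u := by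
  refine le_iInf₂ fun K hK => ?_
  rcases eq_or_ne (⨆ u ∈ K, energy Ω p u) ⊤ with htop | hfin
  · exact le_top.trans_eq htop.symm
  lift (⨆ u ∈ K, energy Ω p u) to ℝ≥0 using hfin with c hc
  refine le_of_forall_pos_le_add_mul c fun κ hκ => ?_
  obtain ⟨K', hK', hle⟩ := hp.exists_mem_familyW0 hN hΩ hΩb hpc hK (c := c)
    (fun u hu => hc ▸ le_iSup₂ (f := fun u (_ : u ∈ K) => energy Ω p u) u hu) hκ
  exact iInf₂_le_of_le K' hK' (iSup₂_le hle)

end BoundedExponent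

theorem exists_boundedExponent (hΩ : IsOpen Ω) (hΩb : Bornology.IsBounded Ω)
    (hpc : ContinuousOn p (closure Ω)) (hp : ∀ x ∈ Ω, 1 ≤ p x) :
    ∃ b, BoundedExponent Ω p b := by
  obtain ⟨b, hb⟩ := (hΩb.isCompact_closure.image_of_continuousOn hpc).bddAbove
  exact ⟨b, hΩ.measurableSet, (hpc.mono subset_closure).aemeasurable hΩ.measurableSet, hp,
    fun x hx => hb (mem_image_of_mem p (subset_closure hx))⟩

theorem AdmissibleExponent.one_lt (hp : AdmissibleExponent Ω p) (hΩb : Bornology.IsBounded Ω)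
    {x : Euc N} (hx : x ∈ Ω) : 1 < p x := by
  have hbdd := (hΩb.isCompact_closure.image_of_continuousOn hp.continuousOn).bddBelow
  exact hp.one_lt_inf.trans_le
    (csInf_le (hbdd.mono (image_mono subset_closure)) (mem_image_of_mem p hx))

end Minimax

end VarExp

theorem theorem2p11_general {N : ℕ} (hN : 2 ≤ N) (Ω : Set (VarExp.Euc N)) (hΩ_open : IsOpen Ω)
    (hΩ_bdd : Bornology.IsBounded Ω) (p : VarExp.Euc N → ℝ) (hp_cont : ContinuousOn p (closure Ω))
    (hp_one : ∀ x ∈ Ω, 1 ≤ p x) :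
    ConvexOn ℝ≥0 Set.univ (VarExp.energy Ω p) ∧
    (∀ u : VarExp.L1 Ω, VarExp.energy Ω p (-u) = VarExp.energy Ω p u) ∧
    (∀ (t : ℝ≥0) (u : VarExp.L1 Ω),
      VarExp.energy Ω p ((t : ℝ) • u) = (t : ℝ≥0∞) * VarExp.energy Ω p u) ∧
    ∀ m : ℕ,
      (⨅ K ∈ VarExp.familyL1 Ω p m, ⨆ u ∈ K, VarExp.energy Ω p u) =
        ⨅ K ∈ VarExp.familyW0 Ω p m, ⨆ u ∈ K, VarExp.energy Ω p u.1 := by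
  obtain ⟨b, hp⟩ := VarExp.exists_boundedExponent hΩ_open hΩ_bdd hp_cont hp_one
  have hE := hp.isExtSeminorm_energy hΩ_open
  exact ⟨hE.convexOn, hE.neg, hE.nnreal_smul, fun m => le_antisymm
    (hp.iInf_familyL1_le hN hΩ_open hΩ_bdd m)
    (hp.iInf_familyW0_le hN hΩ_open hΩ_bdd hp_cont m)⟩

theorem theorem2p11 {N : ℕ} (hN : 2 ≤ N) (Ω : Set (VarExp.Euc N)) (hΩ_open : IsOpen Ω)
    (hΩ_conn : IsConnected Ω) (hΩ_bdd : Bornology.IsBounded Ω)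
    (hΩ_lip : VarExp.HasLipschitzBoundary Ω)
    (p : VarExp.Euc N → ℝ) (hp : VarExp.AdmissibleExponent Ω p) :
    ConvexOn ℝ≥0 Set.univ (VarExp.energy Ω p) ∧
    (∀ u : VarExp.L1 Ω, VarExp.energy Ω p (-u) = VarExp.energy Ω p u) ∧
    (∀ (t : ℝ≥0) (u : VarExp.L1 Ω),
      VarExp.energy Ω p ((t : ℝ) • u) = (t : ℝ≥0∞) * VarExp.energy Ω p u) ∧
    ∀ m : ℕ, 1 ≤ m →
      (⨅ K ∈ VarExp.familyL1 Ω p m, ⨆ u ∈ K, VarExp.energy Ω p u) =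
        ⨅ K ∈ VarExp.familyW0 Ω p m, ⨆ u ∈ K, VarExp.energy Ω p u.1 := by
  obtain ⟨hconv, heven, hhom, hminimax⟩ := theorem2p11_general hN Ω hΩ_open hΩ_bdd p
    hp.continuousOn fun x hx => (hp.one_lt hΩ_bdd hx).le
  exact ⟨hconv, heven, hhom, fun m _ => hminimax m⟩
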